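/- Let $I=[a,b]$ with $a<b$, $\gamma:=\max\{|a|,|b|\}<1$, and let $m$ be Lebesgue measure on $I$. Let $T:I\to I$ be a one-dimensional Iwasawa continued fraction map: there is a countable family of pairwise disjoint non-degenerate subintervals $I_h\subseteq I$ $(h\in\mathcal H)$ that covers $I$ up to a null set, and on each $I_h$ one has $T(x)=\iota_h(x)+c_h$, where $c_h$ is a real constant and $\iota_h$ is one of the inversions $1/x,\,-1/x,\,|1/x|,\,-|1/x|$. Suppose that $TI_h$ is, up to endpoints, the full interval $I$, except possibly for the leftmost and for the rightmost of the intervals $I_h$, and that in these cases too $TI_h$ shares (up to closure) an endpoint with $I$. Write also $h:TI_h\to I_h$ for the inverse branch of $T$. The transfer operator is $$Hf(x)=\sum_{h\in\mathcal H}|h'(x)|\,f(h(x))\,\chi_{TI_h}(x).$$ Let $L^1(I)$ be the space of classes of integrable complex functions on $I$ with norm $\|\cdot\|_1$, and let $BV(I)\subset L^1(I)$ be the space of the $f$ for which $\|f\|_{BV}:=\|f\|_1+\inf_{g=f\text{ a.e.}}\operatorname{Var}_I g$ is finite. Then for every integrable $f$ the series $Hf$ converges almost everywhere, $H$ is a bounded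 operator on $L^1(I)$, it maps $BV(I)$ to itself and is bounded there for $\|\cdot\|_{BV}$, and the hypotheses of the Ionescu-Tulcea–Marinescu theorem hold with $B=L^1(I)$, $L=BV(I)$, $U=H$. That is, $(L^1(I),\|\cdot\|_1)$ and $(BV(I),\|\cdot\|_{BV})$ are complex Banach spaces, $H$ is bounded on $BV(I)$ for both norms, and: (a) if $f_n\in BV(I)$, $\|f_n\|_{BV}\le M$ for all $n$, $f\in L^1(I)$ and $\|f_n-f\|_1\to0$, then $f\in BV(I)$ and $\|f\|_{BV}\le M$; (b) there is a constant $C$ with $\|H^nf\|_1\le C\|f\|_1$ for all $n\ge 0$ and $f\in BV(I)$; and, for some integer $k\ge1$, (c) there are $0<\rho<1$ and $M$ with $\|H^kf\|_{BV}\le\rho\|f\|_{BV}+M\|f\|_1$ for all $f\in BV(I)$; (d) for every bounded subset $L'$ of $BV(I)$, $H^kL'$ has compact closure in $L^1(I)$. Moreover, $H$ as an operator on $BV(I)$ has the corresponding spectral decomposition: the set $G$ of eigenvalues of $H$ of modulus $1$ is finite, the eigenspaces $E_\lambda$ $(\lambda\in G)$ are finite-dimensional, and there are bounded linear operators $H_\lambda$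 $(\lambda\in G)$ and $V$ on $BV(I)$ such that $$H^n=\sum_{\lambda\in G}\lambda^nH_\lambda+V^n\qquad(n\ge1),$$ $H_\lambda^2=H_\lambda$, $H_\lambda H_{\lambda'}=0$ for $\lambda\ne\lambda'$, $H_\lambda V=VH_\lambda=0$, $H_\lambda(BV(I))=E_\lambda$, and the spectral radius of $V$ is less than $1$. Finally, $H$ has spectral radius $r(H)=1$ on $BV(I)$ (so the elements of $G$ are its peripheral eigenvalues), and $H$ is quasi-compact: there are $n\ge1$ and a compact operator $K$ on $BV(I)$ with $\|H^n-K\|<r(H)^n$. -/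

import Mathlib

open MeasureTheory Set Filter Topology
open scoped ENNReal NNReal

noncomputable section

/-! ## The spaces `L¹(I)` and `BV(I)`, where `I = [a, b]` -/

/-- Lebesgue measure `m` on the interval `I = [a, b]`. -/
abbrev intervalMeasure (a b : ℝ) : Measure ℝ := volume.restrict (Icc a b)

/-- The complex Banach space `L¹(I)`. -/
abbrev L1 (a b : ℝ) : Type := Lp ℂ 1 (intervalMeasure a b)

/-- The variation of a class `f ∈ L¹(I)`: the infimum of `Var_I g` over all functions `g` that are
equal to `f` almost everywhere on `I`. -/
def essVar {a b : ℝ} (f : L1 a b) : ℝ≥0∞ :=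
  ⨅ (g : ℝ → ℂ) (_ : g =ᵐ[intervalMeasure a b] f), eVariationOn g (Icc a b)

lemma essVar_le {a b : ℝ} {f : L1 a b} {g : ℝ → ℂ} (h : g =ᵐ[intervalMeasure a b] f) :
    essVar f ≤ eVariationOn g (Icc a b) :=
  iInf₂_le g h

lemma eVariationOn_add_le_add (f g : ℝ → ℂ) (s : Set ℝ) :
    eVariationOn (f + g) s ≤ eVariationOn f s + eVariationOn g s := by
  refine iSup_le fun p => ?_
  calc ∑ i ∈ Finset.range p.1, edist ((f + g) (p.2.1 (i + 1))) ((f + g) (p.2.1 i))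
      ≤ ∑ i ∈ Finset.range p.1, (edist (f (p.2.1 (i + 1))) (f (p.2.1 i))
          + edist (g (p.2.1 (i + 1))) (g (p.2.1 i))) :=
        Finset.sum_le_sum fun i _ => edist_add_add_le _ _ _ _
    _ = _ := Finset.sum_add_distrib
    _ ≤ _ := add_le_add
        (le_iSup (fun p : ℕ × { u : ℕ → ℝ // Monotone u ∧ ∀ i, u i ∈ s } =>
          ∑ i ∈ Finset.range p.1, edist (f (p.2.1 (i + 1))) (f (p.2.1 i))) p)
        (le_iSup (fun p : ℕ × { u : ℕ → ℝ // Monotone u ∧ ∀ i, u i ∈ s } =>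
          ∑ i ∈ Finset.range p.1, edist (g (p.2.1 (i + 1))) (g (p.2.1 i))) p)

lemma eVariationOn_const_smul_le (c : ℂ) (f : ℝ → ℂ) (s : Set ℝ) :
    eVariationOn (c • f) s ≤ ‖c‖ₑ * eVariationOn f s := by
  have h : LipschitzOnWith ‖c‖₊ (fun z : ℂ => c • z) univ := (lipschitzWith_smul c).lipschitzOnWith
  exact h.comp_eVariationOn_le (mapsTo_univ f s)

lemma essVar_zero (a b : ℝ) : essVar (0 : L1 a b) = 0 := by
  refine le_antisymm ((essVar_le (g := fun _ => 0) ?_).trans ?_) bot_le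
  · filter_upwards [Lp.coeFn_zero ℂ 1 (intervalMeasure a b)] with x hx
    exact hx.symm
  · simp [eVariationOn]

lemma essVar_add_le {a b : ℝ} (f g : L1 a b) : essVar (f + g) ≤ essVar f + essVar g := by
  unfold essVar
  rw [ENNReal.iInf_add]
  refine le_iInf fun u => ?_
  rw [ENNReal.iInf_add]
  refine le_iInf fun hu => ?_
  rw [ENNReal.add_iInf]
  refine le_iInf fun v => ?_
  rw [ENNReal.add_iInf]
  refine le_iInf fun hv => ?_
  refine (essVar_le (g := u + v) ?_).trans (eVariationOn_add_le_add u v _)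
  filter_upwards [hu, hv, Lp.coeFn_add f g] with x h1 h2 h3
  rw [Pi.add_apply, h1, h2]
  exact h3.symm

lemma essVar_smul_le {a b : ℝ} (c : ℂ) (f : L1 a b) : essVar (c • f) ≤ ‖c‖ₑ * essVar f := by
  rcases eq_or_ne c 0 with rfl | hc
  · rw [zero_smul, essVar_zero]
    exact bot_le
  have hc0 : ‖c‖ₑ ≠ 0 := by simpa using hc
  conv_rhs => unfold essVar
  rw [ENNReal.mul_iInf_of_ne hc0 enorm_ne_top]
  refine le_iInf fun u => ?_
  rw [ENNReal.mul_iInf_of_ne hc0 enorm_ne_top]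
  refine le_iInf fun hu => ?_
  refine (essVar_le (g := c • u) ?_).trans (eVariationOn_const_smul_le c u _)
  filter_upwards [hu, Lp.coeFn_smul c f] with x h1 h2
  rw [Pi.smul_apply, h1]
  exact h2.symm

lemma essVar_smul {a b : ℝ} (c : ℂ) (f : L1 a b) : essVar (c • f) = ‖c‖ₑ * essVar f := by
  rcases eq_or_ne c 0 with rfl | hc
  · simp [essVar_zero]
  refine le_antisymm (essVar_smul_le c f) ?_
  have h := essVar_smul_le c⁻¹ (c • f)
  rw [smul_smul, inv_mul_cancel₀ hc, one_smul] at h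
  calc ‖c‖ₑ * essVar f ≤ ‖c‖ₑ * (‖c⁻¹‖ₑ * essVar (c • f)) := by gcongr
    _ = essVar (c • f) := by
      rw [← mul_assoc, ← enorm_mul, mul_inv_cancel₀ hc]; simp

/-- The classes in `L¹(I)` of finite variation, as a subspace of `L¹(I)`. -/
def bvSubmodule (a b : ℝ) : Submodule ℂ (L1 a b) where
  carrier := {f | essVar f < ∞}
  zero_mem' := by simp [essVar_zero]
  add_mem' := fun {f g} hf hg => (essVar_add_le f g).trans_lt (ENNReal.add_lt_top.2 ⟨hf, hg⟩)
  smul_mem' := fun c f hf =>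
    (essVar_smul_le c f).trans_lt (ENNReal.mul_lt_top enorm_lt_top hf)

/-- The space `BV(I)`; it carries the norm `‖·‖_BV` below, not the one induced by `L¹(I)`. -/
def BV (a b : ℝ) : Type := bvSubmodule a b

namespace BV

variable {a b : ℝ}

instance : AddCommGroup (BV a b) := inferInstanceAs (AddCommGroup (bvSubmodule a b))

instance : Module ℂ (BV a b) := inferInstanceAs (Module ℂ (bvSubmodule a b))

/-- The inclusion of `BV(I)` in `L¹(I)`. -/
def incl (a b : ℝ) : BV a b →ₗ[ℂ] L1 a b := (bvSubmodule a b).subtype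

lemma incl_injective : Function.Injective (incl a b) := Subtype.val_injective

lemma essVar_incl_ne_top (f : BV a b) : essVar (incl a b f) ≠ ∞ :=
  ne_of_lt (Subtype.property (p := fun g => g ∈ bvSubmodule a b) f)

/-- `‖f‖_BV = ‖f‖₁ + inf {Var_I g | g = f a.e.}`. -/
instance : Norm (BV a b) := ⟨fun f => ‖incl a b f‖ + (essVar (incl a b f)).toReal⟩

lemma norm_def (f : BV a b) : ‖f‖ = ‖incl a b f‖ + (essVar (incl a b f)).toReal := rfl

lemma normCore : NormedSpace.Core ℂ (BV a b) where
  norm_nonneg f := by rw [norm_def]; positivity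
  norm_smul c f := by
    rw [norm_def, norm_def, map_smul, norm_smul, essVar_smul, ENNReal.toReal_mul, toReal_enorm,
      mul_add]
  norm_triangle f g := by
    rw [norm_def, norm_def, norm_def, map_add]
    have h1 := norm_add_le (incl a b f) (incl a b g)
    have h2 := ENNReal.toReal_mono
      (ENNReal.add_ne_top.2 ⟨essVar_incl_ne_top f, essVar_incl_ne_top g⟩)
      (essVar_add_le (incl a b f) (incl a b g))
    rw [ENNReal.toReal_add (essVar_incl_ne_top f) (essVar_incl_ne_top g)] at h2
    linarith
  norm_eq_zero_iff f := by
    constructor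
    · intro h
      rw [norm_def] at h
      have h1 : ‖incl a b f‖ = 0 := by
        have := norm_nonneg (incl a b f)
        have := ENNReal.toReal_nonneg (a := essVar (incl a b f))
        linarith
      exact incl_injective (by rw [norm_eq_zero.1 h1, map_zero])
    · rintro rfl
      simp [norm_def, essVar_zero]

instance : NormedAddCommGroup (BV a b) := NormedAddCommGroup.ofCore normCore

instance : NormedSpace ℂ (BV a b) := NormedSpace.ofCore normCore

end BV

/-! ## One-dimensional Iwasawa continued fractions -/

/-- The four inversions `1/x`, `-1/x`, `|1/x|`, `-|1/x|`. -/
def IsInversion (i : ℝ → ℝ) : Prop :=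
  (i = fun x => 1 / x) ∨ (i = fun x => -(1 / x)) ∨ (i = fun x => |1 / x|) ∨
    (i = fun x => -|1 / x|)

/-- A one-dimensional Iwasawa continued fraction map `T` of `I = [a, b]`. The set of (inverse)
branches is indexed by the countable type `β`; the piece of the partition that belongs to `h` is
`piece h`, on which `T` is an inversion plus a constant. The partition is one up to a null set (so
that endpoints of pieces and the point `0` may be left out). -/
structure IwasawaCF (a b : ℝ) (β : Type*) where
  lt : a < b
  /-- the transformation -/
  T : ℝ → ℝ
  mapsTo : MapsTo T (Icc a b) (Icc a b)
  countable : Countable β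
  /-- the subinterval `I_h` -/
  piece : β → Set ℝ
  piece_subset : ∀ h, piece h ⊆ Icc a b
  piece_ordConnected : ∀ h, (piece h).OrdConnected
  piece_nontrivial : ∀ h, (piece h).Nontrivial
  piece_disjoint : Pairwise fun h h' => Disjoint (piece h) (piece h')
  piece_cover : volume (Icc a b \ ⋃ h, piece h) = 0
  /-- the inversion used on `I_h` -/
  inversion : β → ℝ → ℝ
  isInversion : ∀ h, IsInversion (inversion h)
  /-- the constant used on `I_h` -/
  shift : β → ℝ
  T_eq : ∀ h, ∀ x ∈ piece h, T x = inversion h x + shift h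
  /-- The domain `T I_h` of an inverse branch is the full interval (up to endpoints), unless `I_h`
  is the leftmost or the rightmost piece. -/
  full : ∀ h, closure (T '' piece h) = Icc a b ∨
    (∀ h', h' ≠ h → ∀ x ∈ piece h, ∀ y ∈ piece h', x < y) ∨
    (∀ h', h' ≠ h → ∀ x ∈ piece h, ∀ y ∈ piece h', y < x)
  /-- In every case, `T I_h` shares an endpoint with `I`. -/
  share_endpoint : ∀ h, a ∈ closure (T '' piece h) ∨ b ∈ closure (T '' piece h)

namespace IwasawaCF

variable {a b : ℝ} {β : Type*} (S : IwasawaCF a b β)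

/-- The continued fraction is proper if `γ = max {|a|, |b|} < 1`. -/
def IsProper (_S : IwasawaCF a b β) : Prop := max |a| |b| < 1

/-- The inverse branch `T I_h → I_h` of `T`. -/
def invBranch (h : β) : ℝ → ℝ := Function.invFunOn S.T (S.piece h)

/-- The term `|h'(x)| f(h(x)) χ_{T I_h}(x)` of the transfer operator. -/
def transferTerm (f : ℝ → ℂ) (x : ℝ) (h : β) : ℂ :=
  (S.T '' S.piece h).indicator
    (fun y => ((|derivWithin (S.invBranch h) (S.T '' S.piece h) y| : ℝ) : ℂ)
      * f (S.invBranch h y)) x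

/-- `H` is the transfer operator of `T` on `L¹(I)`: for every integrable function `f` on `I`, the
series `∑ₕ |h'(x)| f(h(x)) χ_{T I_h}(x)` converges to `(H f)(x)` for almost every `x ∈ I`. -/
def IsTransferOperator (H : L1 a b →L[ℂ] L1 a b) : Prop :=
  ∀ (f : ℝ → ℂ) (hf : Integrable f (intervalMeasure a b)),
    ∀ᵐ x ∂(intervalMeasure a b), HasSum (S.transferTerm f x) (H (hf.toL1 f) x)

end IwasawaCF

/-! ## The Ionescu-Tulcea–Marinescu theorem: hypotheses and conclusion -/

section ITM

variable {B L : Type*} [NormedAddCommGroup B] [NormedSpace ℂ B]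
  [NormedAddCommGroup L] [NormedSpace ℂ L]

/-- The hypotheses of the Ionescu-Tulcea–Marinescu theorem for the Banach spaces `(B, |·|)` and
`(L, ‖·‖)`, where `j` is the inclusion of `L` in `B`, and an operator `U` of `L`, which is bounded
for `‖·‖`. -/
structure ITMHypotheses (j : L →ₗ[ℂ] B) (U : L →L[ℂ] L) : Prop where
  complete_B : CompleteSpace B
  complete_L : CompleteSpace L
  inclusion : Function.Injective j
  bounded : ∃ C : ℝ, ∀ f, ‖j (U f)‖ ≤ C * ‖j f‖
  closed_ball : ∀ (M : ℝ) (f : ℕ → L) (g : B), (∀ n, ‖f n‖ ≤ M) →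
    Tendsto (fun n => ‖j (f n) - g‖) atTop (𝓝 0) → ∃ g' : L, j g' = g ∧ ‖g'‖ ≤ M
  power_bounded : ∃ C : ℝ, ∀ (n : ℕ) (f : L), ‖j ((U ^ n) f)‖ ≤ C * ‖j f‖
  lasotaYorke_compact : ∃ k : ℕ, 1 ≤ k ∧
    (∃ ρ M : ℝ, 0 < ρ ∧ ρ < 1 ∧ ∀ f, ‖(U ^ k) f‖ ≤ ρ * ‖f‖ + M * ‖j f‖) ∧
    (∀ L' : Set L, Bornology.IsBounded L' → IsCompact (closure (j '' ((U ^ k) '' L'))))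

/-- The eigenvalues of `U` of modulus `1`. -/
def unitEigenvalues (U : L →L[ℂ] L) : Set ℂ :=
  {l | ‖l‖ = 1 ∧ Module.End.HasEigenvalue (U : Module.End ℂ L) l}

/-- The spectral decomposition in the conclusion of the Ionescu-Tulcea–Marinescu theorem: the set
`G` of eigenvalues of `U` of modulus `1` is finite, their eigenspaces are finite-dimensional, and
`Uⁿ = ∑_{l ∈ G} lⁿ P_l + Vⁿ` for `n ≥ 1`, where the `P_l` are projections onto the eigenspaces,
`P_l P_l' = 0` for `l ≠ l'`, `P_l V = V P_l = 0`, and `V` has spectral radius less than `1`. -/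
def HasITMDecomposition (U : L →L[ℂ] L) : Prop :=
  ∃ hG : (unitEigenvalues U).Finite,
    (∀ l ∈ unitEigenvalues U,
      FiniteDimensional ℂ (Module.End.eigenspace (U : Module.End ℂ L) l)) ∧
    ∃ (P : ℂ → L →L[ℂ] L) (V : L →L[ℂ] L),
      (∀ n : ℕ, 1 ≤ n → U ^ n = ∑ l ∈ hG.toFinset, l ^ n • P l + V ^ n) ∧
      (∀ l ∈ unitEigenvalues U, P l * P l = P l) ∧
      (∀ l ∈ unitEigenvalues U, ∀ l' ∈ unitEigenvalues U, l' ≠ l → P l * P l' = 0) ∧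
      (∀ l ∈ unitEigenvalues U, P l * V = 0 ∧ V * P l = 0) ∧
      (∀ l ∈ unitEigenvalues U,
        (P l : L →ₗ[ℂ] L).range = Module.End.eigenspace (U : Module.End ℂ L) l) ∧
      spectralRadius ℂ V < 1

/-- `U` is quasi-compact: `‖Uⁿ - K‖ < r(U)ⁿ` for some `n ≥ 1` and some compact operator `K`, where
`r(U)` is the spectral radius (so the essential spectral radius is less than `r(U)`). -/
def IsQuasiCompact (U : L →L[ℂ] L) : Prop :=
  ∃ n : ℕ, 1 ≤ n ∧ ∃ K : L →L[ℂ] L, IsCompactOperator K ∧ ‖U ^ n - K‖ₑ < spectralRadius ℂ U ^ n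

end ITM

end

/-!
On a piece `I_h` the map is `T x = σ / x + c` with `σ = ±1`, so the inverse branch is
`h(y) = σ / (y - c)` and its Jacobian is `|h'(y)| = h(y) ^ 2`, a function of the point `h(y)`
alone. Hence `H f` is the sum over `h` of the functions `(t ^ 2 f) ∘ h` on the intervals
`T I_h`. Away from the endpoints of these intervals its variation is at most that of
`t ^ 2 f`, because the `I_h` are
disjoint, and multiplication by `t ^ 2` reduces the variation by a factor close to `γ ^ 2 < 1`, up
to a multiple of the `L¹` norm. What remains are the jumps at the endpoints of the domains `T I_h`
that are not full. They could double the variation, so a single step need not contract it.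

The iterates are therefore treated with a variation that ignores jumps at a finite set of break
points (`BrokenVarLE`). It contracts by a factor `θ < 1` in each step, up to a multiple of the
`L¹` norm (`BrokenVarLE.sq_mul`, `IwasawaCF.brokenVarLE_transfer`), while the set
of break points for the `k`-th iterate, made of the images under `T` of the earlier ones,
the endpoints of the domains and a fixed grid, grows
only linearly in `k` (`IwasawaCF.card_breaks_le`). The jumps at the break points are finally
bounded by the supremum of the function (`exists_essVar_le_of_brokenVarLE`), which loses a factor
linear in `k` against `θ ^ k`. This is the Lasota–Yorke inequality
`IwasawaCF.exists_essVar_transfer_pow_le`. All estimates are made along sets of full measure; the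
passage to an honest representative is the extension lemma `exists_extension_eVariationOn_le`,
which also yields that balls of `BV(I)` are closed in `L¹(I)` and that `BV(I)` is complete. Step
functions show that bounded sets of `BV(I)` are totally bounded in `L¹(I)`.

The spectral decomposition follows from one consequence of these facts
(`ITMHypotheses.approxEigenvectorCompact`): bounded sequences of approximate eigenvectors for a
number of modulus `1` have convergent subsequences. It makes the eigenspaces finite-dimensional,
lets the ergodic averages of `l⁻ⁿ Uⁿ` converge to projections onto the eigenspaces, prevents the
eigenvalues of modulus `1` from accumulating, and excludes spectrum on the unit circle once the
projections are split off, since boundary points of the spectrum are approximate eigenvalues. The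
spectral radius is `1` since `H` is power bounded and `1 - H` is not surjective, all functions in
its range having integral `0`.
-/

/-! ### Variation and representatives -/

/-- A function on a nonempty set of reals extends to the real line without increasing its
variation. The extension is the limit, along an ultrafilter of finite subsets `F` of `D`, of `f`
precomposed with the rounding of a real number down to an element of `F`. -/
lemma exists_extension_eVariationOn_le (f : ℝ → ℂ) {D : Set ℝ} (hD : D.Nonempty) :
    ∃ g : ℝ → ℂ, EqOn g f D ∧ eVariationOn g univ ≤ eVariationOn f D := by
  classical
  by_cases hf : eVariationOn f D = ∞
  · exact ⟨f, fun _ _ => rfl, by rw [hf]; exact le_top⟩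
  obtain ⟨d, hd⟩ := hD
  let A : Finset D → Finset ℝ := fun F => insert d (F.image Subtype.val)
  have hA : ∀ F, (A F).Nonempty := fun F => Finset.insert_nonempty _ _
  have hAD : ∀ F, ∀ x ∈ A F, x ∈ D := by
    intro F x hx
    rcases Finset.mem_insert.1 hx with rfl | hx
    · exact hd
    · obtain ⟨y, -, rfl⟩ := Finset.mem_image.1 hx
      exact y.2
  let R : Finset D → ℝ → Finset ℝ := fun F x =>
    insert ((A F).min' (hA F)) ((A F).filter (· ≤ x))
  have hR : ∀ F x, (R F x).Nonempty := fun F x => Finset.insert_nonempty _ _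
  let r : Finset D → ℝ → ℝ := fun F x => (R F x).max' (hR F x)
  have hRA : ∀ F x, R F x ⊆ A F := by
    intro F x
    refine Finset.insert_subset (Finset.min'_mem _ _) (Finset.filter_subset _ _)
  have hrD : ∀ F x, r F x ∈ D := fun F x => hAD F _ (hRA F x (Finset.max'_mem _ _))
  have hrmono : ∀ F, Monotone (r F) := by
    intro F x y hxy
    refine Finset.max'_subset _ (Finset.insert_subset_insert _ ?_)
    intro z hz
    rw [Finset.mem_filter] at hz ⊢
    exact ⟨hz.1, hz.2.trans hxy⟩
  have hrid : ∀ F (x : D), x ∈ F → r F x = x := by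
    intro F x hx
    have hxA : (x : ℝ) ∈ A F := Finset.mem_insert_of_mem (Finset.mem_image_of_mem _ hx)
    refine le_antisymm (Finset.max'_le _ _ _ ?_) (Finset.le_max' _ _ ?_)
    · intro y hy
      rcases Finset.mem_insert.1 hy with rfl | hy
      · exact Finset.min'_le _ _ hxA
      · exact (Finset.mem_filter.1 hy).2
    · exact Finset.mem_insert_of_mem (Finset.mem_filter.2 ⟨hxA, le_rfl⟩)
  let U : Ultrafilter (Finset D) := Ultrafilter.of atTop
  have hlim : ∀ x, ∃ l, Tendsto (fun F => f (r F x)) U (𝓝 l) := by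
    intro x
    have hb : ∀ F, f (r F x) ∈ Metric.closedBall (f d) (eVariationOn f D).toReal := fun F =>
      BoundedVariationOn.dist_le hf (hrD F x) hd
    obtain ⟨l, -, hl⟩ := (isCompact_closedBall (f d) _).ultrafilter_le_nhds
      (U.map fun F => f (r F x)) (le_principal_iff.2 (mem_map.2 (Eventually.of_forall hb)))
    exact ⟨l, hl⟩
  choose g hg using hlim
  refine ⟨g, fun x hx => ?_, ?_⟩
  · refine tendsto_nhds_unique (hg x) (tendsto_const_nhds.congr' ?_)
    have : ∀ᶠ F in (U : Filter (Finset D)), {(⟨x, hx⟩ : D)} ≤ F :=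
      (Ultrafilter.of_le atTop) (eventually_ge_atTop _)
    filter_upwards [this] with F hF
    rw [hrid F ⟨x, hx⟩ (by simpa using hF)]
  · by_contra! hlt
    obtain ⟨F, hF⟩ :=
      (eVariationOn.lowerSemicontinuous_aux (fun x _ => hg x) hlt).exists
    refine absurd hF (not_lt.2 ?_)
    exact eVariationOn.comp_le_of_monotoneOn f (r F) ((hrmono F).monotoneOn _)
      (fun x _ => hrD F x)

/-- The essential variation is at most the variation along any set of full measure. -/
lemma essVar_le_eVariationOn_of_ae_mem {a b : ℝ} (hab : a < b) {f : L1 a b} {D : Set ℝ}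
    (hD : ∀ᵐ x ∂intervalMeasure a b, x ∈ D) : essVar f ≤ eVariationOn f D := by
  have : NeBot (ae (intervalMeasure a b)) := by
    rw [ae_neBot, Ne, Measure.restrict_eq_zero, Real.volume_Icc]
    simpa using hab
  obtain ⟨g, hg, hv⟩ := exists_extension_eVariationOn_le f hD.exists
  refine (essVar_le (g := g) ?_).trans ((eVariationOn.mono g (subset_univ _)).trans hv)
  filter_upwards [hD] with x hx using hg hx

/-- Increments over non-overlapping segments add up to at most the total variation. -/
lemma sum_edist_le_eVariationOn {ι : Type*} (g : ℝ → ℂ) {a b : ℝ} (s : Finset ι) (x y : ι → ℝ)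
    (hx : ∀ i ∈ s, a ≤ x i) (hxy : ∀ i ∈ s, x i ≤ y i) (hy : ∀ i ∈ s, y i ≤ b)
    (hd : ∀ i ∈ s, ∀ j ∈ s, i ≠ j → Disjoint (Ioo (x i) (y i)) (Ioo (x j) (y j))) :
    ∑ i ∈ s, edist (g (y i)) (g (x i)) ≤ eVariationOn g (Icc a b) := by
  classical
  -- The segment with the largest left endpoint is split off; the others lie to its left.
  induction s using Finset.induction_on_max_value x generalizing b with
  | empty => simp
  | insert i s hi hmax ih =>
    rw [Finset.sum_insert hi]
    have hi' := Finset.mem_insert_self i s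
    have hs' : ∀ j ∈ s, j ∈ insert i s := fun j hj => Finset.mem_insert_of_mem hj
    rcases (hxy i hi').eq_or_lt with h0 | h0
    · rw [h0, edist_self, zero_add]
      exact ih (fun j hj => hx j (hs' j hj)) (fun j hj => hxy j (hs' j hj))
        (fun j hj => hy j (hs' j hj)) (fun j hj k hk => hd j (hs' j hj) k (hs' k hk))
    · have hle : ∀ j ∈ s, y j ≤ x i := by
        intro j hj
        by_contra! hlt
        obtain ⟨z, hz1, hz2⟩ := exists_between (lt_min hlt h0)
        refine (Set.disjoint_left.1 (hd j (hs' j hj) i hi' (ne_of_mem_of_not_mem hj hi))) (a := z)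
          ⟨?_, ?_⟩ ⟨hz1, ?_⟩
        · exact (hmax j hj).trans_lt hz1
        · exact hz2.trans_le (min_le_left _ _)
        · exact hz2.trans_le (min_le_right _ _)
      have h1 := ih (b := x i) (fun j hj => hx j (hs' j hj)) (fun j hj => hxy j (hs' j hj)) hle
        (fun j hj k hk => hd j (hs' j hj) k (hs' k hk))
      have h2 : edist (g (y i)) (g (x i)) ≤ eVariationOn g (Icc (x i) b) :=
        eVariationOn.edist_le g ⟨hxy i hi', hy i hi'⟩ ⟨le_rfl, (hxy i hi').trans (hy i hi')⟩
      have h3 := eVariationOn.Icc_add_Icc g (s := univ) (hx i hi')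
        ((hxy i hi').trans (hy i hi')) (mem_univ _)
      simp only [univ_inter] at h3
      rw [← h3, add_comm]
      exact add_le_add h1 h2

lemma integrableOn_coeFn {a b : ℝ} (f : L1 a b) : IntegrableOn f (Icc a b) volume :=
  L1.integrable_coeFn f

lemma norm_eq_setIntegral {a b : ℝ} (f : L1 a b) : ‖f‖ = ∫ x in Icc a b, ‖f x‖ :=
  L1.norm_eq_integral_norm f

/-- On every interval some point of a given set of full measure has a value at most the mean. -/
lemma exists_norm_mul_le_setIntegral {a b u w : ℝ} (huw : u < w) (hs : Ioo u w ⊆ Icc a b)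
    (f : L1 a b) {D : Set ℝ} (hD : ∀ᵐ x ∂intervalMeasure a b, x ∈ D) :
    ∃ z ∈ D, z ∈ Ioo u w ∧ ‖f z‖ * (w - u) ≤ ∫ x in Ioo u w, ‖f x‖ := by
  have hD' : ∀ᵐ x ∂volume.restrict (Ioo u w), x ∈ D ∧ x ∈ Ioo u w :=
    (ae_restrict_of_ae_restrict_of_subset hs hD).and (ae_restrict_mem measurableSet_Ioo)
  have hf : IntegrableOn (fun x => ‖f x‖) (Ioo u w) :=
    (((integrableOn_coeFn f).mono_set hs)).norm
  have h0 : volume.restrict (Ioo u w) ≠ 0 := by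
    rw [Ne, Measure.restrict_eq_zero, Real.volume_Ioo]
    simpa using huw
  obtain ⟨z, hz, hle⟩ := exists_notMem_null_le_average h0 hf (ae_iff.1 hD')
  have hz' : z ∈ D ∧ z ∈ Ioo u w := not_not.1 hz
  refine ⟨z, hz'.1, hz'.2, ?_⟩
  rw [average_eq] at hle
  have hr : (volume.restrict (Ioo u w)).real univ = w - u := by
    simp [Measure.real, huw.le]
  rw [hr, smul_eq_mul, inv_mul_eq_div, le_div_iff₀ (sub_pos.2 huw)] at hle
  exact hle

/-! ### Completeness and compactness -/

namespace BV

variable {a b : ℝ}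

lemma exists_incl_eq {f : L1 a b} (hf : essVar f < ∞) : ∃ g : BV a b, incl a b g = f :=
  ⟨⟨f, hf⟩, rfl⟩

/-- Representatives of almost minimal variation. -/
lemma exists_representative (f : BV a b) {v : ℝ} (hv : (essVar (incl a b f)).toReal < v) :
    ∃ g : ℝ → ℂ, g =ᵐ[intervalMeasure a b] incl a b f ∧
      eVariationOn g (Icc a b) ≤ ENNReal.ofReal v := by
  have hlt : essVar (incl a b f) < ENNReal.ofReal v := by
    rwa [ENNReal.lt_ofReal_iff_toReal_lt (essVar_incl_ne_top _)]
  obtain ⟨g, hg⟩ := iInf_lt_iff.1 hlt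
  obtain ⟨hg', hg⟩ := iInf_lt_iff.1 hg
  exact ⟨g, hg', hg.le⟩

lemma norm_incl_le (f : BV a b) : ‖incl a b f‖ ≤ ‖f‖ := by
  rw [norm_def]; simp

/-- The balls of `BV(I)` are closed in `L¹(I)`. -/
theorem exists_of_tendsto_incl (hab : a < b) (M : ℝ) (f : ℕ → BV a b) (g : L1 a b)
    (hf : ∀ n, ‖f n‖ ≤ M)
    (hfg : Tendsto (fun n => ‖incl a b (f n) - g‖) atTop (𝓝 0)) :
    ∃ g' : BV a b, incl a b g' = g ∧ ‖g'‖ ≤ M := by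
  have hlim : Tendsto (fun n => incl a b (f n)) atTop (𝓝 g) :=
    tendsto_iff_norm_sub_tendsto_zero.2 hfg
  have key : essVar g ≤ ENNReal.ofReal (M - ‖g‖) := by
    obtain ⟨ns, hns, hae⟩ := (tendstoInMeasure_of_tendsto_Lp hlim).exists_seq_tendsto_ae
    -- Near-optimal representatives, compared with the classes along a common set of full measure.
    have hrep : ∀ n, ∃ u : ℝ → ℂ, u =ᵐ[intervalMeasure a b] incl a b (f (ns n)) ∧
        eVariationOn u (Icc a b)
          ≤ ENNReal.ofReal ((essVar (incl a b (f (ns n)))).toReal + 1 / (n + 1)) := fun n =>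
      exists_representative _ (lt_add_of_pos_right _ (by positivity))
    choose u hu hv using hrep
    let D : Set ℝ := {x | x ∈ Icc a b ∧ (∀ n, u n x = incl a b (f (ns n)) x) ∧
      Tendsto (fun n => incl a b (f (ns n)) x) atTop (𝓝 (g x))}
    have hD : ∀ᵐ x ∂intervalMeasure a b, x ∈ D := by
      filter_upwards [ae_restrict_mem measurableSet_Icc, ae_all_iff.2 hu, hae] with x h1 h2 h3
      exact ⟨h1, h2, h3⟩
    refine (essVar_le_eVariationOn_of_ae_mem hab hD).trans ?_
    refine le_of_forall_lt_imp_le_of_dense fun v hvlt => ?_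
    have hev := eVariationOn.lowerSemicontinuous_aux
      (F := fun n => u n) (p := atTop) (s := D) (f := g)
      (fun x hx => by simpa only [hx.2.1] using hx.2.2) hvlt
    have hev' : ∀ᶠ n in atTop, v ≤ ENNReal.ofReal (M - ‖incl a b (f (ns n))‖ + 1 / (n + 1)) := by
      filter_upwards [hev] with n hn
      refine hn.le.trans ((eVariationOn.mono _ fun x hx => hx.1).trans ((hv n).trans ?_))
      refine ENNReal.ofReal_le_ofReal ?_
      have := hf (ns n)
      rw [norm_def] at this
      linarith
    refine ge_of_tendsto (ENNReal.tendsto_ofReal ?_) hev'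
    have h1 : Tendsto (fun n => ‖incl a b (f (ns n))‖) atTop (𝓝 ‖g‖) :=
      (hlim.comp hns.tendsto_atTop).norm
    simpa using (h1.const_sub M).add tendsto_one_div_add_atTop_nhds_zero_nat
  have hM : ‖g‖ ≤ M := le_of_tendsto hlim.norm
    (Eventually.of_forall fun n => (norm_incl_le (f n)).trans (hf n))
  obtain ⟨g', rfl⟩ := exists_incl_eq (key.trans_lt ENNReal.ofReal_lt_top)
  refine ⟨g', rfl, ?_⟩
  rw [norm_def]
  have := ENNReal.toReal_le_of_le_ofReal (sub_nonneg.2 hM) key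
  linarith

/-- `BV(I)` is complete: the limit in `L¹(I)` of a Cauchy sequence is also its limit in `BV(I)`,
because the balls are closed in `L¹(I)`. -/
theorem completeSpace (hab : a < b) : CompleteSpace (BV a b) := by
  refine Metric.complete_of_cauchySeq_tendsto fun f hf => ?_
  have hj : CauchySeq fun n => incl a b (f n) := by
    rw [Metric.cauchySeq_iff'] at hf ⊢
    intro ε hε
    obtain ⟨N, hN⟩ := hf ε hε
    refine ⟨N, fun n hn => lt_of_le_of_lt ?_ (hN n hn)⟩
    rw [dist_eq_norm, dist_eq_norm, ← map_sub]
    exact norm_incl_le _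
  obtain ⟨g, hg⟩ := cauchySeq_tendsto_of_complete hj
  have key : ∀ ε > 0, ∃ N, ∀ m ≥ N, ∃ g' : BV a b, incl a b g' = g - incl a b (f m) ∧
      ‖g'‖ ≤ ε := by
    intro ε hε
    obtain ⟨N, hN⟩ := Metric.cauchySeq_iff.1 hf ε hε
    refine ⟨N, fun m hm => ?_⟩
    refine exists_of_tendsto_incl hab ε (fun n => f (n + N) - f m) _ (fun n => ?_) ?_
    · rw [← dist_eq_norm]
      exact (hN _ (by omega) m hm).le
    · have h1 := (tendsto_add_atTop_iff_nat N).2 hg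
      refine (tendsto_iff_norm_sub_tendsto_zero.1 h1).congr fun n => ?_
      rw [map_sub, sub_sub_sub_cancel_right]
  obtain ⟨N₀, h₀⟩ := key 1 one_pos
  obtain ⟨g₀, hg₀, -⟩ := h₀ N₀ le_rfl
  refine ⟨g₀ + f N₀, Metric.tendsto_atTop.2 fun ε hε => ?_⟩
  obtain ⟨N, hN⟩ := key (ε / 2) (by positivity)
  refine ⟨N, fun n hn => ?_⟩
  obtain ⟨g', hg', hle⟩ := hN n hn
  have : g₀ + f N₀ - f n = g' := by
    apply incl_injective
    rw [map_sub, map_add, hg₀, hg', sub_add_cancel]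
  rw [dist_comm, dist_eq_norm, this]
  linarith

/-- A representative of bounded variation is bounded by its variation and the `L¹` norm. -/
lemma norm_representative_le (hab : a < b) (f : L1 a b) {g : ℝ → ℂ} {v : ℝ} (hv0 : 0 ≤ v)
    (hg : g =ᵐ[intervalMeasure a b] f) (hv : eVariationOn g (Icc a b) ≤ ENNReal.ofReal v)
    {x : ℝ} (hx : x ∈ Icc a b) : ‖g x‖ ≤ v + ‖f‖ / (b - a) := by
  obtain ⟨z, hz, hzI, hle⟩ := exists_norm_mul_le_setIntegral hab Ioo_subset_Icc_self f hg
  have h1 : dist (g x) (g z) ≤ v := by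
    rw [← ENNReal.ofReal_le_ofReal_iff hv0, ← edist_dist]
    exact (eVariationOn.edist_le g hx (Ioo_subset_Icc_self hzI)).trans hv
  have h2 : ‖g z‖ ≤ ‖f‖ / (b - a) := by
    rw [show g z = f z from hz, le_div_iff₀ (sub_pos.2 hab), norm_eq_setIntegral]
    refine hle.trans (setIntegral_mono_set (integrableOn_coeFn f).norm
      (Eventually.of_forall fun _ => norm_nonneg _) Ioo_subset_Icc_self.eventuallyLE)
  rw [dist_eq_norm] at h1
  have := norm_le_norm_add_norm_sub' (g x) (g z)
  linarith

end BV

/-- A cell of the partition of `[a, ∞)` into intervals of length `d`. -/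
def gridCell (a d : ℝ) (i : ℕ) : Set ℝ := {x | ⌊(x - a) / d⌋₊ = i}

lemma measurableSet_gridCell (a d : ℝ) (i : ℕ) : MeasurableSet (gridCell a d i) :=
  ((measurable_id.sub_const a).div_const d).nat_floor (measurableSet_singleton i)

lemma mem_Icc_of_mem_gridCell {a d x : ℝ} {i : ℕ} (hd : 0 < d) (hx : a ≤ x)
    (hi : x ∈ gridCell a d i) : x ∈ Icc (a + i * d) (a + (i + 1 : ℕ) * d) := by
  have h0 : 0 ≤ (x - a) / d := div_nonneg (sub_nonneg.2 hx) hd.le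
  have h1 := Nat.floor_le h0
  have h2 := Nat.lt_floor_add_one ((x - a) / d)
  rw [show ⌊(x - a) / d⌋₊ = i from hi] at h1 h2
  rw [le_div_iff₀ hd] at h1
  rw [div_lt_iff₀ hd] at h2
  push_cast
  constructor <;> linarith

/-- The class of the step function with the values `c i` on the cells of a uniform partition. -/
noncomputable def stepClass (a b d : ℝ) {N : ℕ} (c : Fin N → ℂ) : L1 a b :=
  ∑ i, c i • indicatorConstLp 1 (measurableSet_gridCell a d i)
    (measure_ne_top (intervalMeasure a b) _) (1 : ℂ)

lemma continuous_stepClass (a b d : ℝ) (N : ℕ) :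
    Continuous (stepClass a b d : (Fin N → ℂ) → L1 a b) := by
  unfold stepClass
  fun_prop

lemma stepClass_ae_eq (a b d : ℝ) {N : ℕ} (c : Fin N → ℂ) :
    ∀ᵐ x ∂intervalMeasure a b, ∀ i : Fin N, x ∈ gridCell a d i → stepClass a b d c x = c i := by
  have h1 : stepClass a b d c =ᵐ[intervalMeasure a b] fun x => ∑ i : Fin N,
      (c i • indicatorConstLp 1 (measurableSet_gridCell a d i)
        (measure_ne_top (intervalMeasure a b) _) (1 : ℂ) : L1 a b) x := by
    unfold stepClass
    exact Lp.coeFn_fun_finsetSum _ _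
  have h2 : ∀ᵐ x ∂intervalMeasure a b, ∀ i : Fin N,
      (c i • indicatorConstLp 1 (measurableSet_gridCell a d i)
        (measure_ne_top (intervalMeasure a b) _) (1 : ℂ) : L1 a b) x
        = c i • (gridCell a d i).indicator (fun _ => (1 : ℂ)) x := by
    refine ae_all_iff.2 fun i => ?_
    filter_upwards [Lp.coeFn_smul (c i) (indicatorConstLp 1 (measurableSet_gridCell a d i)
        (measure_ne_top (intervalMeasure a b) _) (1 : ℂ)),
      indicatorConstLp_coeFn (p := 1) (hs := measurableSet_gridCell a d i)
        (hμs := measure_ne_top (intervalMeasure a b) _) (c := (1 : ℂ))] with x h3 h4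
    rw [h3, Pi.smul_apply, h4]
  filter_upwards [h1, h2] with x h1 h2 i hi
  rw [h1, Finset.sum_eq_single i]
  · rw [h2, indicator_of_mem hi, smul_eq_mul, mul_one]
  · intro j _ hj
    rw [h2, indicator_of_notMem, smul_zero]
    exact fun hx => hj (Fin.ext (hx.symm.trans hi))
  · simp

/-- A class of bounded variation is approximated in `L¹(I)`, up to the mesh times its variation, by
a step function on a uniform partition. -/
lemma exists_norm_sub_stepClass_le {a b : ℝ} (f : L1 a b) {g : ℝ → ℂ} {v : ℝ} (hv0 : 0 ≤ v)
    (hg : g =ᵐ[intervalMeasure a b] f) (hv : eVariationOn g (Icc a b) ≤ ENNReal.ofReal v)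
    {N : ℕ} {d : ℝ} (hd : 0 < d) (hN : b - a = N * d) :
    ∃ c : Fin (N + 1) → ℂ, (∀ i, ∃ x ∈ Icc a b, c i = g x) ∧
      ‖f - stepClass a b d c‖ ≤ d * v := by
  let c : Fin (N + 1) → ℂ := fun i => g (a + i * d)
  let V : ℕ → ℝ≥0∞ := fun i =>
    eVariationOn g (Icc a b ∩ Icc (a + i * d) (a + (i + 1 : ℕ) * d))
  have hmem : ∀ i : ℕ, i ≤ N → a + i * d ∈ Icc a b := by
    intro i hi
    have h1 : (i : ℝ) * d ≤ N * d := by gcongr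
    have h2 : (0 : ℝ) ≤ i * d := by positivity
    constructor <;> linarith
  refine ⟨c, fun i => ⟨_, hmem i (Nat.lt_succ_iff.1 i.2), rfl⟩, ?_⟩
  have hsum : ∑ i ∈ Finset.range (N + 1), V i ≤ ENNReal.ofReal v := by
    have hmono : Monotone fun i : ℕ => a + i * d := fun i j hij => by
      dsimp only; gcongr
    have := eVariationOn.sum g (s := Icc a b) hmono (n := N + 1)
      (fun i _ hi => hmem i (Nat.lt_succ_iff.1 hi))
    refine this.le.trans ((eVariationOn.mono g inter_subset_left).trans hv)
  have hpt : ∀ᵐ x ∂intervalMeasure a b, ‖(f - stepClass a b d c) x‖ₑ ≤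
      ∑ i ∈ Finset.range (N + 1), (gridCell a d i).indicator (fun _ => V i) x := by
    filter_upwards [ae_restrict_mem measurableSet_Icc, hg, stepClass_ae_eq a b d c,
      Lp.coeFn_sub f (stepClass a b d c)] with x hx hgx hstep hsub
    have hiN : ⌊(x - a) / d⌋₊ < N + 1 := by
      refine Nat.lt_succ_of_le (Nat.floor_le_of_le ?_)
      rw [div_le_iff₀ hd, ← hN]
      linarith [hx.2]
    have hi : x ∈ gridCell a d ⌊(x - a) / d⌋₊ := rfl
    refine le_trans ?_ (Finset.single_le_sum (fun _ _ => zero_le) (Finset.mem_range.2 hiN))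
    rw [indicator_of_mem hi, hsub, Pi.sub_apply, hstep ⟨_, hiN⟩ hi, ← hgx, ← edist_eq_enorm_sub]
    have hxc := mem_Icc_of_mem_gridCell hd hx.1 hi
    exact eVariationOn.edist_le g ⟨hx, hxc⟩
      ⟨hmem _ (Nat.lt_succ_iff.1 hiN), le_rfl, hxc.1.trans hxc.2⟩
  have hvol : ∀ i : ℕ, intervalMeasure a b (gridCell a d i) ≤ ENNReal.ofReal d := by
    intro i
    rw [Measure.restrict_apply (measurableSet_gridCell a d i)]
    refine (measure_mono fun x hx => mem_Icc_of_mem_gridCell hd hx.2.1 hx.1).trans_eq ?_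
    rw [Real.volume_Icc]
    congr 1
    push_cast
    ring
  have hle : ‖f - stepClass a b d c‖ₑ ≤ ENNReal.ofReal (d * v) := by
    rw [Lp.enorm_def, eLpNorm_one_eq_lintegral_enorm]
    calc _ ≤ ∫⁻ x in Icc a b,
          ∑ i ∈ Finset.range (N + 1), (gridCell a d i).indicator (fun _ => V i) x :=
          lintegral_mono_ae hpt
      _ = ∑ i ∈ Finset.range (N + 1), V i * intervalMeasure a b (gridCell a d i) := by
          rw [lintegral_finsetSum _ fun i _ =>
            measurable_const.indicator (measurableSet_gridCell a d i)]
          exact Finset.sum_congr rfl fun i _ =>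
            lintegral_indicator_const (measurableSet_gridCell a d i) _
      _ ≤ ∑ i ∈ Finset.range (N + 1), V i * ENNReal.ofReal d :=
          Finset.sum_le_sum fun i _ => mul_le_mul_right (hvol i) _
      _ = (∑ i ∈ Finset.range (N + 1), V i) * ENNReal.ofReal d := by rw [Finset.sum_mul]
      _ ≤ ENNReal.ofReal v * ENNReal.ofReal d := by gcongr
      _ = ENNReal.ofReal (d * v) := by rw [ENNReal.ofReal_mul hd.le, mul_comm]
  rw [← toReal_enorm]
  exact ENNReal.toReal_le_of_le_ofReal (by positivity) hle

namespace BV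

variable {a b : ℝ}

/-- Bounded sets of `BV(I)` are totally bounded in `L¹(I)`. -/
theorem totallyBounded_image_incl (hab : a < b) {s : Set (BV a b)} (hs : Bornology.IsBounded s) :
    TotallyBounded (incl a b '' s) := by
  obtain ⟨R, hR⟩ := hs.exists_norm_le
  rcases s.eq_empty_or_nonempty with rfl | ⟨f₀, hf₀⟩
  · simp
  have hR0 : 0 ≤ R := (norm_nonneg _).trans (hR f₀ hf₀)
  have hba := sub_pos.2 hab
  refine Metric.totallyBounded_iff.2 fun ε hε => ?_
  obtain ⟨N, hN⟩ := exists_nat_gt ((b - a) * (R + 1) / (ε / 2))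
  have hNpos : (0 : ℝ) < N := lt_of_le_of_lt (by positivity) hN
  let d := (b - a) / N
  have hd : 0 < d := by positivity
  have hNd : b - a = N * d := by simp only [d]; field_simp
  have hdR : d * (R + 1) < ε / 2 := by
    rw [div_lt_iff₀ (by positivity)] at hN
    simp only [d]
    rw [div_mul_eq_mul_div, div_lt_iff₀ hNpos]
    linarith
  have hcomp := (isCompact_closedBall (0 : Fin (N + 1) → ℂ) (R + 1 + R / (b - a))).image
    (continuous_stepClass a b d (N + 1))
  obtain ⟨t, ht, hcover⟩ := Metric.totallyBounded_iff.1 hcomp.totallyBounded (ε / 2) (by positivity)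
  refine ⟨t, ht, ?_⟩
  rintro _ ⟨f, hf, rfl⟩
  have hfR := hR f hf
  have hnn := norm_nonneg (incl a b f)
  obtain ⟨g, hg, hv⟩ := exists_representative f (v := R + 1) (by rw [norm_def] at hfR; linarith)
  obtain ⟨c, hc, hle⟩ := exists_norm_sub_stepClass_le _ (by positivity) hg hv hd hNd
  have hcK : c ∈ Metric.closedBall (0 : Fin (N + 1) → ℂ) (R + 1 + R / (b - a)) := by
    rw [mem_closedBall_zero_iff, pi_norm_le_iff_of_nonneg (by positivity)]
    intro i
    obtain ⟨x, hx, hcx⟩ := hc i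
    rw [hcx]
    refine (norm_representative_le hab _ (by positivity) hg hv hx).trans ?_
    gcongr
    exact (norm_incl_le f).trans hfR
  obtain ⟨y, hy, hyc⟩ := mem_iUnion₂.1 (hcover (mem_image_of_mem _ hcK))
  refine mem_iUnion₂.2 ⟨y, hy, ?_⟩
  rw [Metric.mem_ball] at hyc ⊢
  have := dist_triangle (incl a b f) (stepClass a b d c) y
  rw [dist_eq_norm _ (stepClass a b d c)] at this
  linarith

/-- Bounded sets of `BV(I)` are relatively compact in `L¹(I)`. -/
theorem isCompact_closure_image_incl (hab : a < b) {s : Set (BV a b)}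
    (hs : Bornology.IsBounded s) : IsCompact (closure (incl a b '' s)) :=
  (totallyBounded_image_incl hab hs).closure.isCompact_of_isClosed isClosed_closure

end BV

namespace IwasawaCF

variable {a b : ℝ} {β : Type*} (S : IwasawaCF a b β)

/-! ### The branches of an Iwasawa continued fraction map -/

lemma abs_inversion (h : β) (x : ℝ) : |S.inversion h x| = |1 / x| := by
  rcases S.isInversion h with h | h | h | h <;> rw [h] <;> simp

/-- A piece does not contain `0`, because an inversion is unbounded near `0`, whereas `T` takes
its values in `I`. -/
lemma zero_notMem_piece (h : β) : (0 : ℝ) ∉ S.piece h := by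
  intro h0
  obtain ⟨y, hy, hy0⟩ := (S.piece_nontrivial h).exists_ne 0
  obtain ⟨n, hn⟩ := exists_nat_gt ((max |a| |b| + |S.shift h|) * |y|)
  have hn0 : (0 : ℝ) < n := lt_of_le_of_lt (by positivity) hn
  have hmem : y / n ∈ S.piece h := by
    refine (S.piece_ordConnected h).uIcc_subset h0 hy ?_
    rw [mem_uIcc]
    have h1 : (1 : ℝ) ≤ n := by exact_mod_cast Nat.pos_of_ne_zero (by rintro rfl; simp at hn0)
    rcases le_total 0 y with h2 | h2
    · exact Or.inl ⟨by positivity, div_le_self h2 h1⟩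
    · refine Or.inr ⟨?_, div_nonpos_of_nonpos_of_nonneg h2 hn0.le⟩
      rw [le_div_iff₀ hn0]
      nlinarith
  have hT := S.T_eq h _ hmem
  have hI := S.mapsTo (S.piece_subset h hmem)
  have h1 : |S.inversion h (y / n)| ≤ max |a| |b| + |S.shift h| := by
    have : S.inversion h (y / n) = S.T (y / n) - S.shift h := by linarith
    rw [this]
    exact (abs_sub _ _).trans (add_le_add (abs_le_max_abs_abs hI.1 hI.2) le_rfl)
  rw [abs_inversion, one_div_div, abs_div, Nat.abs_cast, div_le_iff₀ (abs_pos.2 hy0)] at h1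
  linarith

/-- On each piece `T` is of the form `x ↦ σ / x + c` with `σ = ±1`. -/
lemma exists_sign (h : β) : ∃ σ : ℝ, σ ^ 2 = 1 ∧
    ∀ x ∈ S.piece h, S.T x = σ / x + S.shift h := by
  have hsgn : (∀ x ∈ S.piece h, 0 < x) ∨ (∀ x ∈ S.piece h, x < 0) := by
    by_contra! hcon
    obtain ⟨⟨x, hx, hx0⟩, y, hy, hy0⟩ := hcon
    exact S.zero_notMem_piece h ((S.piece_ordConnected h).out hx hy ⟨hx0, hy0⟩)
  have key : ∀ σ : ℝ, σ ^ 2 = 1 → (∀ x ∈ S.piece h, S.inversion h x = σ / x) →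
      ∃ σ : ℝ, σ ^ 2 = 1 ∧ ∀ x ∈ S.piece h, S.T x = σ / x + S.shift h :=
    fun σ hσ hinv => ⟨σ, hσ, fun x hx => by rw [S.T_eq h x hx, hinv x hx]⟩
  rcases S.isInversion h with hi | hi | hi | hi
  · exact key 1 (by norm_num) fun x _ => by rw [hi]
  · exact key (-1) (by norm_num) fun x _ => by rw [hi]; ring
  · rcases hsgn with hs | hs
    · exact key 1 (by norm_num) fun x hx => by
        rw [hi]; exact abs_of_pos (one_div_pos.2 (hs x hx))
    · exact key (-1) (by norm_num) fun x hx => by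
        rw [hi]; exact (abs_of_neg (one_div_neg.2 (hs x hx))).trans (by ring)
  · rcases hsgn with hs | hs
    · exact key (-1) (by norm_num) fun x hx => by
        rw [hi]; exact (congrArg Neg.neg (abs_of_pos (one_div_pos.2 (hs x hx)))).trans (by ring)
    · exact key 1 (by norm_num) fun x hx => by
        rw [hi]; exact (congrArg Neg.neg (abs_of_neg (one_div_neg.2 (hs x hx)))).trans (by ring)

lemma ne_zero_of_mem_piece {h : β} {x : ℝ} (hx : x ∈ S.piece h) : x ≠ 0 :=
  fun h0 => S.zero_notMem_piece h (h0 ▸ hx)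

/-- The image `T I_h` of a piece, the domain of the inverse branch. -/
def branchDomain (h : β) : Set ℝ := S.T '' S.piece h

lemma injOn_T (h : β) : InjOn S.T (S.piece h) := by
  obtain ⟨σ, hσ, hT⟩ := S.exists_sign h
  intro x hx y hy hxy
  rw [hT x hx, hT y hy, add_left_inj, div_eq_div_iff (S.ne_zero_of_mem_piece hx)
    (S.ne_zero_of_mem_piece hy)] at hxy
  exact (mul_left_cancel₀ (by rintro rfl; norm_num at hσ) hxy).symm

lemma differentiableOn_T (h : β) : DifferentiableOn ℝ S.T (S.piece h) := by
  obtain ⟨σ, -, hT⟩ := S.exists_sign h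
  refine DifferentiableOn.congr (f := fun x => σ / x + S.shift h) ?_ hT
  exact ((differentiableOn_const σ).div differentiableOn_id
    fun x hx => S.ne_zero_of_mem_piece hx).add_const _

lemma continuousOn_T (h : β) : ContinuousOn S.T (S.piece h) :=
  (S.differentiableOn_T h).continuousOn

lemma branchDomain_subset (h : β) : S.branchDomain h ⊆ Icc a b :=
  (image_mono (S.piece_subset h)).trans S.mapsTo.image_subset

lemma ordConnected_branchDomain (h : β) : (S.branchDomain h).OrdConnected :=
  ((S.piece_ordConnected h).isPreconnected.image _ (S.continuousOn_T h)).ordConnected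

lemma nontrivial_branchDomain (h : β) : (S.branchDomain h).Nontrivial :=
  (S.piece_nontrivial h).image_of_injOn (S.injOn_T h)

lemma invBranch_mem {h : β} {y : ℝ} (hy : y ∈ S.branchDomain h) : S.invBranch h y ∈ S.piece h :=
  Function.invFunOn_mem hy

lemma T_invBranch {h : β} {y : ℝ} (hy : y ∈ S.branchDomain h) : S.T (S.invBranch h y) = y :=
  Function.invFunOn_eq hy

lemma invBranch_T {h : β} {x : ℝ} (hx : x ∈ S.piece h) : S.invBranch h (S.T x) = x :=
  S.injOn_T h (S.invBranch_mem (mem_image_of_mem _ hx)) hx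
    (S.T_invBranch (mem_image_of_mem _ hx))

lemma image_invBranch (h : β) : S.invBranch h '' S.branchDomain h = S.piece h := by
  refine Subset.antisymm (image_subset_iff.2 fun y hy => S.invBranch_mem hy) fun x hx => ?_
  exact ⟨S.T x, mem_image_of_mem _ hx, S.invBranch_T hx⟩

lemma injOn_invBranch (h : β) : InjOn (S.invBranch h) (S.branchDomain h) := by
  intro x hx y hy hxy
  rw [← S.T_invBranch hx, ← S.T_invBranch hy, hxy]

lemma measurableSet_branchDomain (h : β) : MeasurableSet (S.branchDomain h) :=
  (S.ordConnected_branchDomain h).measurableSet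

lemma measurableSet_piece (h : β) : MeasurableSet (S.piece h) :=
  (S.piece_ordConnected h).measurableSet

/-- Since an inverse branch is `h(y) = σ / (y - c)` with `σ = ±1`, its Jacobian at `y` is
`h(y) ^ 2`, a function of `h(y)` alone. -/
lemma exists_hasDerivWithinAt_invBranch {h : β} {y : ℝ} (hy : y ∈ S.branchDomain h) :
    ∃ m : ℝ, HasDerivWithinAt (S.invBranch h) m (S.branchDomain h) y ∧
      |m| = S.invBranch h y ^ 2 := by
  obtain ⟨σ, hσ, hT⟩ := S.exists_sign h
  have hσ0 : σ ≠ 0 := by rintro rfl; norm_num at hσ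
  have hform : ∀ z ∈ S.branchDomain h,
      z - S.shift h ≠ 0 ∧ S.invBranch h z = σ / (z - S.shift h) := by
    intro z hz
    have h1 := hT _ (S.invBranch_mem hz)
    rw [S.T_invBranch hz] at h1
    have h2 := S.ne_zero_of_mem_piece (S.invBranch_mem hz)
    have h3 : z - S.shift h = σ / S.invBranch h z := by linarith
    rw [h3]
    exact ⟨div_ne_zero hσ0 h2, (div_div_cancel₀ hσ0).symm⟩
  have h1 : HasDerivAt (fun z => σ / (z - S.shift h)) (-σ / (y - S.shift h) ^ 2) y := by
    have := (hasDerivAt_const y σ).fun_div ((hasDerivAt_id y).sub_const (S.shift h)) (hform y hy).1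
    simp only [id, zero_mul, mul_one, zero_sub] at this
    exact this
  refine ⟨_, h1.hasDerivWithinAt.congr (fun z hz => (hform z hz).2) (hform y hy).2, ?_⟩
  rw [(hform y hy).2, abs_div, abs_neg, abs_of_nonneg (sq_nonneg (y - S.shift h)), div_pow, hσ]
  congr 1
  rw [← sq_abs] at hσ
  exact (pow_eq_one_iff_of_nonneg (abs_nonneg σ) two_ne_zero).1 hσ

lemma hasDerivWithinAt_invBranch {h : β} {y : ℝ} (hy : y ∈ S.branchDomain h) :
    HasDerivWithinAt (S.invBranch h) (derivWithin (S.invBranch h) (S.branchDomain h) y)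
      (S.branchDomain h) y :=
  (S.exists_hasDerivWithinAt_invBranch hy).choose_spec.1.differentiableWithinAt.hasDerivWithinAt

lemma abs_derivWithin_invBranch {h : β} {y : ℝ} (hy : y ∈ S.branchDomain h) :
    |derivWithin (S.invBranch h) (S.branchDomain h) y| = S.invBranch h y ^ 2 := by
  obtain ⟨m, hm, habs⟩ := S.exists_hasDerivWithinAt_invBranch hy
  have hconv : Convex ℝ (S.branchDomain h) := (S.ordConnected_branchDomain h).convex
  have huniq : UniqueDiffOn ℝ (S.branchDomain h) :=
    uniqueDiffOn_convex hconv
      (hconv.nontrivial_iff_nonempty_interior.1 (S.nontrivial_branchDomain h))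
  rw [hm.derivWithin (huniq y hy), habs]

/-! ### The transfer operator on `L¹(I)` -/

lemma transferTerm_of_mem (f : ℝ → ℂ) {h : β} {y : ℝ} (hy : y ∈ S.branchDomain h) :
    S.transferTerm f y h
      = ((S.invBranch h y ^ 2 : ℝ) : ℂ) * f (S.invBranch h y) := by
  rw [transferTerm, indicator_of_mem (show y ∈ S.T '' S.piece h from hy),
    ← S.abs_derivWithin_invBranch hy]
  rfl

lemma transferTerm_of_notMem (f : ℝ → ℂ) {h : β} {y : ℝ} (hy : y ∉ S.branchDomain h) :
    S.transferTerm f y h = 0 :=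
  indicator_of_notMem hy _

lemma transferTerm_eq_indicator (f : ℝ → ℂ) (h : β) :
    (fun y => S.transferTerm f y h) = (S.branchDomain h).indicator fun y =>
      |derivWithin (S.invBranch h) (S.branchDomain h) y| • f (S.invBranch h y) := by
  ext y
  by_cases hy : y ∈ S.branchDomain h
  · rw [S.transferTerm_of_mem f hy, indicator_of_mem hy, S.abs_derivWithin_invBranch hy,
      Complex.real_smul]
  · rw [S.transferTerm_of_notMem f hy, indicator_of_notMem hy]

lemma lintegral_enorm_transferTerm (f : ℝ → ℂ) (h : β) :
    ∫⁻ y in Icc a b, ‖S.transferTerm f y h‖ₑ = ∫⁻ x in S.piece h, ‖f x‖ₑ := by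
  have h1 : (fun y => ‖S.transferTerm f y h‖ₑ) = (S.branchDomain h).indicator fun y =>
      ENNReal.ofReal |derivWithin (S.invBranch h) (S.branchDomain h) y|
        * ‖f (S.invBranch h y)‖ₑ := by
    ext y
    rw [show S.transferTerm f y h = _ from congrFun (S.transferTerm_eq_indicator f h) y,
      enorm_indicator_eq_indicator_enorm]
    congr 1
    ext y
    rw [enorm_smul, Real.enorm_eq_ofReal_abs, abs_abs]
  rw [h1, setLIntegral_indicator (S.measurableSet_branchDomain h),
    inter_eq_self_of_subset_left (S.branchDomain_subset h), ← S.image_invBranch h]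
  exact (lintegral_image_eq_lintegral_abs_deriv_mul (S.measurableSet_branchDomain h)
    (fun y hy => S.hasDerivWithinAt_invBranch hy) (S.injOn_invBranch h) fun x => ‖f x‖ₑ).symm

lemma integrable_transferTerm {f : ℝ → ℂ} (hf : Integrable f (intervalMeasure a b)) (h : β) :
    Integrable (fun y => S.transferTerm f y h) (intervalMeasure a b) := by
  rw [transferTerm_eq_indicator, integrable_indicator_iff (S.measurableSet_branchDomain h)]
  refine IntegrableOn.restrict ?_
  rw [← integrableOn_image_iff_integrableOn_abs_deriv_smul (S.measurableSet_branchDomain h)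
    (fun y hy => S.hasDerivWithinAt_invBranch hy) (S.injOn_invBranch h), S.image_invBranch]
  exact IntegrableOn.mono_set hf (S.piece_subset h)

lemma integral_transferTerm (f : ℝ → ℂ) (h : β) :
    ∫ y in Icc a b, S.transferTerm f y h = ∫ x in S.piece h, f x := by
  rw [transferTerm_eq_indicator, setIntegral_indicator (S.measurableSet_branchDomain h),
    inter_eq_self_of_subset_right (S.branchDomain_subset h), ← S.image_invBranch h]
  exact (integral_image_eq_integral_abs_deriv_smul (S.measurableSet_branchDomain h)
    (fun y hy => S.hasDerivWithinAt_invBranch hy) (S.injOn_invBranch h) _).symm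

lemma transferTerm_add (f g : ℝ → ℂ) (y : ℝ) (h : β) :
    S.transferTerm (f + g) y h = S.transferTerm f y h + S.transferTerm g y h := by
  by_cases hy : y ∈ S.branchDomain h
  · simp only [S.transferTerm_of_mem _ hy, Pi.add_apply, mul_add]
  · simp only [S.transferTerm_of_notMem _ hy, add_zero]

lemma transferTerm_smul (c : ℂ) (f : ℝ → ℂ) (y : ℝ) (h : β) :
    S.transferTerm (c • f) y h = c * S.transferTerm f y h := by
  by_cases hy : y ∈ S.branchDomain h
  · simp only [S.transferTerm_of_mem _ hy, Pi.smul_apply, smul_eq_mul]; ring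
  · simp only [S.transferTerm_of_notMem _ hy, mul_zero]

lemma transferTerm_congr_ae {f g : ℝ → ℂ} (hf : Integrable f (intervalMeasure a b))
    (hg : Integrable g (intervalMeasure a b)) (hfg : f =ᵐ[intervalMeasure a b] g) (h : β) :
    (fun y => S.transferTerm f y h) =ᵐ[intervalMeasure a b] fun y => S.transferTerm g y h := by
  have hsub := S.lintegral_enorm_transferTerm (f + (-1 : ℂ) • g) h
  have h0 : ∫⁻ x in S.piece h, ‖(f + (-1 : ℂ) • g) x‖ₑ = 0 := by
    rw [← lintegral_zero (μ := volume.restrict (S.piece h))]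
    refine lintegral_congr_ae ?_
    filter_upwards [ae_restrict_of_ae_restrict_of_subset (S.piece_subset h) hfg] with x hx
    simp [hx]
  rw [h0, lintegral_eq_zero_iff' (S.integrable_transferTerm
    (hf.add (hg.smul (-1 : ℂ))) h).aestronglyMeasurable.enorm] at hsub
  filter_upwards [hsub] with y hy
  rw [Pi.zero_apply, enorm_eq_zero, transferTerm_add, transferTerm_smul, neg_one_mul,
    ← sub_eq_add_neg, sub_eq_zero] at hy
  exact hy

/-- The contribution of one branch to the transfer operator, as an operator on `L¹(I)`. -/
noncomputable def branchOperator (h : β) : L1 a b →ₗ[ℂ] L1 a b where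
  toFun f := (S.integrable_transferTerm (L1.integrable_coeFn f) h).toL1 _
  map_add' f g := by
    rw [← Integrable.toL1_add, Integrable.toL1_eq_toL1_iff]
    filter_upwards [S.transferTerm_congr_ae (L1.integrable_coeFn (f + g))
      ((L1.integrable_coeFn f).add (L1.integrable_coeFn g)) (Lp.coeFn_add f g) h] with y hy
    rw [hy, transferTerm_add]
    rfl
  map_smul' c f := by
    rw [RingHom.id_apply, ← Integrable.toL1_smul, Integrable.toL1_eq_toL1_iff]
    filter_upwards [S.transferTerm_congr_ae (L1.integrable_coeFn (c • f))
      ((L1.integrable_coeFn f).smul c) (Lp.coeFn_smul c f) h] with y hy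
    rw [hy, transferTerm_smul]
    rfl

lemma branchOperator_ae_eq (h : β) (f : L1 a b) :
    S.branchOperator h f =ᵐ[intervalMeasure a b] fun y => S.transferTerm f y h :=
  (S.integrable_transferTerm (L1.integrable_coeFn f) h).coeFn_toL1

lemma enorm_branchOperator (h : β) (f : L1 a b) :
    ‖S.branchOperator h f‖ₑ = ∫⁻ x in S.piece h, ‖f x‖ₑ := by
  rw [← S.lintegral_enorm_transferTerm f h, Lp.enorm_def, eLpNorm_one_eq_lintegral_enorm]
  refine lintegral_congr_ae ?_
  filter_upwards [S.branchOperator_ae_eq h f] with y hy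
  rw [hy]

lemma ae_eq_iUnion_piece : (⋃ h, S.piece h) =ᵐ[volume] Icc a b :=
  (iUnion_subset S.piece_subset).eventuallyLE.antisymm (ae_le_set.2 S.piece_cover)

lemma tsum_enorm_branchOperator (f : L1 a b) : ∑' h, ‖S.branchOperator h f‖ₑ = ‖f‖ₑ := by
  have := S.countable
  simp_rw [enorm_branchOperator]
  rw [← lintegral_iUnion S.measurableSet_piece S.piece_disjoint, Lp.enorm_def,
    eLpNorm_one_eq_lintegral_enorm, setLIntegral_congr S.ae_eq_iUnion_piece]

lemma summable_branchOperator (f : L1 a b) : Summable fun h => S.branchOperator h f :=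
  Summable.of_enorm (by rw [tsum_enorm_branchOperator]; exact enorm_ne_top)

/-- The transfer operator on `L¹(I)`, a contraction. -/
noncomputable def transfer : L1 a b →L[ℂ] L1 a b :=
  LinearMap.mkContinuous
    { toFun := fun f => ∑' h, S.branchOperator h f
      map_add' := fun f g => by
        simp_rw [map_add]
        exact (S.summable_branchOperator f).tsum_add (S.summable_branchOperator g)
      map_smul' := fun c f => by
        simp_rw [map_smul]
        exact (S.summable_branchOperator f).tsum_const_smul c } 1 <| fun f => by
    rw [one_mul, ← toReal_enorm, ← toReal_enorm f]
    refine ENNReal.toReal_mono enorm_ne_top ?_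
    rw [← S.tsum_enorm_branchOperator f]
    exact enorm_tsum_le_tsum_enorm

lemma transfer_apply (f : L1 a b) : S.transfer f = ∑' h, S.branchOperator h f := rfl

lemma norm_transfer_le (f : L1 a b) : ‖S.transfer f‖ ≤ ‖f‖ := by
  simpa using S.transfer.le_of_opNorm_le (LinearMap.mkContinuous_norm_le _ zero_le_one _) f

lemma norm_transfer_pow_le (n : ℕ) (f : L1 a b) : ‖(S.transfer ^ n) f‖ ≤ ‖f‖ := by
  induction n with
  | zero => simp
  | succ n ih =>
    rw [pow_succ', mul_apply_eq_comp]
    exact (S.norm_transfer_le _).trans ih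

lemma ae_hasSum_transferTerm (f : L1 a b) :
    ∀ᵐ x ∂intervalMeasure a b, HasSum (S.transferTerm f x) (S.transfer f x) := by
  have := S.countable
  filter_upwards [Lp.hasSum_coeFn_tsum (f := fun h => S.branchOperator h f)
    (by rw [tsum_enorm_branchOperator]; exact enorm_ne_top),
    ae_all_iff.2 fun h => S.branchOperator_ae_eq h f] with x hx hh
  simpa only [hh, ← transfer_apply] using hx

theorem isTransferOperator_transfer : S.IsTransferOperator S.transfer := by
  have := S.countable
  intro f hf
  filter_upwards [S.ae_hasSum_transferTerm (hf.toL1 f), ae_all_iff.2 fun h =>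
    S.transferTerm_congr_ae (L1.integrable_coeFn _) hf hf.coeFn_toL1 h] with x hx hh
  exact hx.congr_fun fun h => (hh h).symm

/-- The transfer operator preserves the integral. -/
theorem integral_transfer (f : L1 a b) :
    ∫ x in Icc a b, S.transfer f x = ∫ x in Icc a b, f x := by
  have := S.countable
  have h1 : HasSum (fun h => L1.integralCLM (E := ℂ) (S.branchOperator h f))
      (L1.integralCLM (E := ℂ) (S.transfer f)) :=
    (S.summable_branchOperator f).hasSum.mapL (L1.integralCLM (E := ℂ))
  have h2 : HasSum (fun h => ∫ x in S.piece h, f x) (∫ x in ⋃ h, S.piece h, f x) :=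
    hasSum_integral_iUnion S.measurableSet_piece S.piece_disjoint
      ((integrableOn_coeFn f).mono_set (iUnion_subset S.piece_subset))
  rw [setIntegral_congr_set S.ae_eq_iUnion_piece] at h2
  have h3 : ∀ h, L1.integralCLM (E := ℂ) (S.branchOperator h f) = ∫ x in S.piece h, f x := by
    intro h
    rw [← L1.integral_eq, L1.integral_eq_integral, ← S.integral_transferTerm]
    exact integral_congr_ae (S.branchOperator_ae_eq h f)
  simp_rw [h3] at h1
  rw [← L1.integral_eq_integral, L1.integral_eq]
  exact h1.unique h2

end IwasawaCF

/-! ### Variation with free jumps at finitely many points -/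

/-- Families of non-overlapping segments `[x i, y i]` (in either orientation) with endpoints in `D`
that avoid the set `P` of break points. -/
structure IsSegmentFamily {ι : Type*} (P D : Set ℝ) (x y : ι → ℝ) : Prop where
  left_mem : ∀ i, x i ∈ D
  right_mem : ∀ i, y i ∈ D
  avoid : ∀ i, Disjoint (uIcc (x i) (y i)) P
  disjoint : Pairwise fun i j => Disjoint (uIoo (x i) (y i)) (uIoo (x j) (y j))

/-- The variation of `f` along `D` is at most `v`, if jumps across the points of `P` are not
counted. -/
def BrokenVarLE (P D : Set ℝ) (f : ℝ → ℂ) (v : ℝ) : Prop :=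
  ∀ (n : ℕ) (x y : Fin n → ℝ), IsSegmentFamily P D x y → ∑ i, ‖f (y i) - f (x i)‖ ≤ v

lemma BrokenVarLE.sum_le {P D : Set ℝ} {f : ℝ → ℂ} {v : ℝ} (hf : BrokenVarLE P D f v)
    {ι : Type*} [Fintype ι] {x y : ι → ℝ} (h : IsSegmentFamily P D x y) :
    ∑ i, ‖f (y i) - f (x i)‖ ≤ v := by
  let e := (Fintype.equivFin ι).symm
  rw [← e.sum_comp]
  exact hf _ _ _ ⟨fun i => h.left_mem _, fun i => h.right_mem _, fun i => h.avoid _,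
    fun i j hij => h.disjoint (e.injective.ne hij)⟩

lemma BrokenVarLE.norm_sub_le {P D : Set ℝ} {f : ℝ → ℂ} {v : ℝ} (hf : BrokenVarLE P D f v)
    {x y : ℝ} (hx : x ∈ D) (hy : y ∈ D) (hxy : Disjoint (uIcc x y) P) : ‖f y - f x‖ ≤ v := by
  simpa using hf.sum_le (ι := Unit) (x := fun _ => x) (y := fun _ => y)
    ⟨fun _ => hx, fun _ => hy, fun _ => hxy, fun _ _ h => absurd rfl h⟩

lemma BrokenVarLE.nonneg {P D : Set ℝ} {f : ℝ → ℂ} {v : ℝ} (hf : BrokenVarLE P D f v) :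
    0 ≤ v := by
  simpa using hf 0 Fin.elim0 Fin.elim0
    ⟨fun i => i.elim0, fun i => i.elim0, fun i => i.elim0, fun i => i.elim0⟩

/-- `P` cuts `[a, b]` into pieces of length at most `δ`. -/
def HasMesh (P : Set ℝ) (a b δ : ℝ) : Prop :=
  ∀ x ∈ Icc a b, ∀ y ∈ Icc a b, Disjoint (uIcc x y) P → |y - x| ≤ δ

lemma HasMesh.mono {P Q : Set ℝ} {a b δ : ℝ} (hP : HasMesh P a b δ) (h : P ⊆ Q) :
    HasMesh Q a b δ :=
  fun x hx y hy hxy => hP x hx y hy (hxy.mono_right h)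

lemma exists_finset_hasMesh (a b : ℝ) {δ : ℝ} (hδ : 0 < δ) :
    ∃ P : Finset ℝ, HasMesh P a b δ := by
  obtain ⟨N, hN⟩ := exists_nat_ge ((b - a) / δ)
  refine ⟨(Finset.range (N + 1)).image fun i : ℕ => a + i * δ, ?_⟩
  have key : ∀ x y, a ≤ x → y ≤ b → δ < y - x →
      ∃ t ∈ (((Finset.range (N + 1)).image fun i : ℕ => a + i * δ : Finset ℝ) : Set ℝ),
        t ∈ Icc x y := by
    intro x y hx hy hxy
    have h1 := Nat.le_ceil ((x - a) / δ)
    have h2 := Nat.ceil_lt_add_one (div_nonneg (sub_nonneg.2 hx) hδ.le)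
    rw [div_le_iff₀ hδ] at h1
    rw [← sub_lt_iff_lt_add, lt_div_iff₀ hδ] at h2
    have h3 : (⌈(x - a) / δ⌉₊ : ℝ) * δ ≤ b - a := by linarith
    refine ⟨a + ⌈(x - a) / δ⌉₊ * δ, ?_, by linarith, by linarith⟩
    rw [Finset.mem_coe, Finset.mem_image]
    refine ⟨_, Finset.mem_range.2 (Nat.lt_succ_of_le ?_), rfl⟩
    rw [← le_div_iff₀ hδ] at h3
    exact_mod_cast h3.trans hN
  intro x hx y hy hxy
  by_contra! hlt
  rcases le_total x y with h | h
  · rw [abs_of_nonneg (sub_nonneg.2 h)] at hlt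
    obtain ⟨t, ht, htI⟩ := key x y hx.1 hy.2 hlt
    exact disjoint_left.1 hxy (Icc_subset_uIcc htI) ht
  · rw [abs_of_nonpos (sub_nonpos.2 h), neg_sub] at hlt
    obtain ⟨t, ht, htI⟩ := key y x hy.1 hx.2 hlt
    exact disjoint_left.1 hxy (Icc_subset_uIcc' htI) ht

lemma uIoo_subset_Icc {a b x y : ℝ} (hx : x ∈ Icc a b) (hy : y ∈ Icc a b) :
    uIoo x y ⊆ Icc a b :=
  (uIoo_subset_uIcc_self).trans (ordConnected_Icc.uIcc_subset hx hy)

lemma sum_setIntegral_norm_le {a b : ℝ} (f : L1 a b) {ι : Type*} [Fintype ι] {P D : Set ℝ}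
    (hD : D ⊆ Icc a b) {x y : ι → ℝ} (h : IsSegmentFamily P D x y) :
    ∑ i, ∫ t in uIoo (x i) (y i), ‖f t‖ ≤ ‖f‖ := by
  have hsub : ∀ i, uIoo (x i) (y i) ⊆ Icc a b := fun i =>
    uIoo_subset_Icc (hD (h.left_mem i)) (hD (h.right_mem i))
  rw [norm_eq_setIntegral, ← integral_iUnion_fintype (s := fun i => uIoo (x i) (y i))
    (fun i => measurableSet_Ioo) h.disjoint
    (fun i => IntegrableOn.mono_set (integrableOn_coeFn f).norm (hsub i))]
  exact setIntegral_mono_set (integrableOn_coeFn f).norm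
    (Eventually.of_forall fun _ => norm_nonneg _) (iUnion_subset hsub).eventuallyLE

/-- Multiplication by `t ^ 2`, which is the Jacobian of the inverse branches, contracts the broken
variation up to a term controlled by the `L¹` norm: on a short segment `f` is bounded by its mean
plus its variation. -/
lemma BrokenVarLE.sq_mul {a b δ v : ℝ} {f : L1 a b} {P D : Set ℝ} (hf : BrokenVarLE P D f v)
    (hD : D ⊆ Icc a b) (hDae : ∀ᵐ x ∂intervalMeasure a b, x ∈ D) (hδ : 0 ≤ δ)
    (hP : HasMesh P a b δ) :
    BrokenVarLE P D (fun t => ((t ^ 2 : ℝ) : ℂ) * f t)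
      ((max |a| |b| ^ 2 + 2 * max |a| |b| * δ) * v + 2 * max |a| |b| * ‖f‖) := by
  intro n x y h
  set γ := max |a| |b| with hγ
  have hγ0 : 0 ≤ γ := (abs_nonneg a).trans (le_max_left _ _)
  have habs : ∀ t ∈ D, |t| ≤ γ := fun t ht => abs_le_max_abs_abs (hD ht).1 (hD ht).2
  have hz : ∀ i, ∃ z ∈ D, z ∈ uIcc (x i) (y i) ∧
      ‖f z‖ * |y i - x i| ≤ ∫ t in uIoo (x i) (y i), ‖f t‖ := by
    intro i
    rcases eq_or_ne (x i) (y i) with h0 | h0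
    · exact ⟨x i, h.left_mem i, left_mem_uIcc, by simp [h0]⟩
    · have hlt : x i ⊓ y i < x i ⊔ y i := inf_lt_sup.2 h0
      obtain ⟨z, hz, hzI, hle⟩ := exists_norm_mul_le_setIntegral hlt
        (uIoo_subset_Icc (hD (h.left_mem i)) (hD (h.right_mem i))) f hDae
      exact ⟨z, hz, Ioo_subset_Icc_self hzI, by rwa [sup_sub_inf_eq_abs_sub] at hle⟩
  choose z hzD hzI hle using hz
  have hfam : IsSegmentFamily P D x z := by
    refine ⟨h.left_mem, hzD, fun i => (h.avoid i).mono_left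
      (uIcc_subset_uIcc left_mem_uIcc (hzI i)), fun i j hij => (h.disjoint hij).mono ?_ ?_⟩
    all_goals exact Ioo_subset_Ioo (le_inf inf_le_left (hzI _).1) (sup_le le_sup_left (hzI _).2)
  have h1 := hf.sum_le h
  have h2 := hf.sum_le hfam
  have h3 := sum_setIntegral_norm_le f hD h
  have hterm : ∀ i, ‖(((y i) ^ 2 : ℝ) : ℂ) * f (y i) - (((x i) ^ 2 : ℝ) : ℂ) * f (x i)‖ ≤
      γ ^ 2 * ‖f (y i) - f (x i)‖ + 2 * γ * δ * ‖f (z i) - f (x i)‖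
        + 2 * γ * ∫ t in uIoo (x i) (y i), ‖f t‖ := by
    intro i
    have hd := hP _ (hD (h.left_mem i)) _ (hD (h.right_mem i)) (h.avoid i)
    have hx := habs _ (h.left_mem i)
    have hy := habs _ (h.right_mem i)
    have e1 : (((y i) ^ 2 : ℝ) : ℂ) * f (y i) - (((x i) ^ 2 : ℝ) : ℂ) * f (x i)
        = (((y i) ^ 2 : ℝ) : ℂ) * (f (y i) - f (x i))
          + (((y i) ^ 2 - (x i) ^ 2 : ℝ) : ℂ) * f (x i) := by
      push_cast; ring
    have e2 : |y i ^ 2 - x i ^ 2| ≤ 2 * γ * |y i - x i| := by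
      rw [sq_sub_sq, abs_mul]
      gcongr
      exact (abs_add_le _ _).trans (by linarith)
    have e3 : ‖f (x i)‖ ≤ ‖f (z i)‖ + ‖f (z i) - f (x i)‖ := by
      have := norm_sub_norm_le (f (x i)) (f (z i))
      rw [norm_sub_rev] at this
      linarith
    rw [e1]
    refine (norm_add_le _ _).trans ?_
    rw [norm_mul, norm_mul, Complex.norm_real, Complex.norm_real, Real.norm_eq_abs,
      Real.norm_eq_abs, abs_pow]
    calc |y i| ^ 2 * ‖f (y i) - f (x i)‖ + |y i ^ 2 - x i ^ 2| * ‖f (x i)‖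
        ≤ γ ^ 2 * ‖f (y i) - f (x i)‖
          + 2 * γ * |y i - x i| * (‖f (z i)‖ + ‖f (z i) - f (x i)‖) := by gcongr
      _ = γ ^ 2 * ‖f (y i) - f (x i)‖ + 2 * γ * |y i - x i| * ‖f (z i) - f (x i)‖
          + 2 * γ * (‖f (z i)‖ * |y i - x i|) := by ring
      _ ≤ _ := by gcongr; exact hle i
  calc _ ≤ ∑ i, (γ ^ 2 * ‖f (y i) - f (x i)‖ + 2 * γ * δ * ‖f (z i) - f (x i)‖
        + 2 * γ * ∫ t in uIoo (x i) (y i), ‖f t‖) := Finset.sum_le_sum fun i _ => hterm i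
    _ = γ ^ 2 * ∑ i, ‖f (y i) - f (x i)‖ + 2 * γ * δ * ∑ i, ‖f (z i) - f (x i)‖
        + 2 * γ * ∑ i, ∫ t in uIoo (x i) (y i), ‖f t‖ := by
        simp only [Finset.sum_add_distrib, Finset.mul_sum]
    _ ≤ γ ^ 2 * v + 2 * γ * δ * v + 2 * γ * ‖f‖ := by gcongr
    _ = _ := by ring

/-- The broken variation is at most the variation of a representative. -/
lemma brokenVarLE_of_eVariationOn_le {a b v : ℝ} {f g : ℝ → ℂ} (P : Set ℝ) (hv0 : 0 ≤ v)
    (hv : eVariationOn g (Icc a b) ≤ ENNReal.ofReal v) :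
    BrokenVarLE P {x | x ∈ Icc a b ∧ g x = f x} f v := by
  intro n x y h
  have h1 := sum_edist_le_eVariationOn g (a := a) (b := b) Finset.univ
    (fun i => x i ⊓ y i) (fun i => x i ⊔ y i)
    (fun i _ => le_inf (h.left_mem i).1.1 (h.right_mem i).1.1) (fun i _ => inf_le_sup)
    (fun i _ => sup_le (h.left_mem i).1.2 (h.right_mem i).1.2)
    (fun i _ j _ hij => h.disjoint hij)
  have h2 : ∀ i, edist (g (x i ⊔ y i)) (g (x i ⊓ y i)) = ENNReal.ofReal ‖f (y i) - f (x i)‖ := by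
    intro i
    rw [← (h.left_mem i).2, ← (h.right_mem i).2, ← dist_eq_norm, ← edist_dist]
    rcases le_total (x i) (y i) with hxy | hxy
    · rw [sup_eq_right.2 hxy, inf_eq_left.2 hxy]
    · rw [sup_eq_left.2 hxy, inf_eq_right.2 hxy, edist_comm]
  simp only [h2] at h1
  rw [← ENNReal.ofReal_sum_of_nonneg fun _ _ => norm_nonneg _] at h1
  exact (ENNReal.ofReal_le_ofReal_iff hv0).1 (h1.trans hv)

/-- A continuous injective function on a segment is monotone or antitone, so it maps the segment
into the one spanned by its values at the endpoints. -/
lemma mapsTo_uIcc_of_injOn {f : ℝ → ℝ} {p q : ℝ} (hc : ContinuousOn f (uIcc p q))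
    (hi : InjOn f (uIcc p q)) :
    MapsTo f (uIcc p q) (uIcc (f p) (f q)) ∧ MapsTo f (uIoo p q) (uIoo (f p) (f q)) := by
  wlog hpq : p ≤ q generalizing p q
  · rw [uIcc_comm p q, uIcc_comm (f p), uIoo_comm p q, uIoo_comm (f p)]
    rw [uIcc_comm] at hc hi
    exact this hc hi (le_of_not_ge hpq)
  rw [uIcc_of_le hpq] at hc hi ⊢
  rw [uIoo_of_le hpq]
  have hp : p ∈ Icc p q := left_mem_Icc.2 hpq
  have hq : q ∈ Icc p q := right_mem_Icc.2 hpq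
  rcases hc.strictMonoOn_of_injOn_Icc' hpq hi with hm | hm
  · refine ⟨fun t ht => Icc_subset_uIcc ⟨hm.monotoneOn hp ht ht.1, hm.monotoneOn ht hq ht.2⟩,
      fun t ht => Ioo_subset_uIoo ?_⟩
    have ht' := Ioo_subset_Icc_self ht
    exact ⟨hm hp ht' ht.1, hm ht' hq ht.2⟩
  · refine ⟨fun t ht => Icc_subset_uIcc' ⟨hm.antitoneOn ht hq ht.2, hm.antitoneOn hp ht ht.1⟩,
      fun t ht => Ioo_subset_uIoo' ?_⟩
    have ht' := Ioo_subset_Icc_self ht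
    exact ⟨hm ht' hq ht.2, hm hp ht' ht.1⟩

namespace IwasawaCF

variable {a b : ℝ} {β : Type*} (S : IwasawaCF a b β)

/-- The endpoints of the domains `T I_h` of the inverse branches. -/
def endpoints : Set ℝ :=
  Set.range (fun h => sInf (S.branchDomain h)) ∪ Set.range (fun h => sSup (S.branchDomain h))

lemma bddBelow_branchDomain (h : β) : BddBelow (S.branchDomain h) :=
  bddBelow_Icc.mono (S.branchDomain_subset h)

lemma bddAbove_branchDomain (h : β) : BddAbove (S.branchDomain h) :=
  bddAbove_Icc.mono (S.branchDomain_subset h)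

/-- All branches are full, except for at most two. -/
lemma finite_setOf_not_full : {h : β | closure (S.branchDomain h) ≠ Icc a b}.Finite := by
  have h1 : {h | ∀ h', h' ≠ h → ∀ x ∈ S.piece h, ∀ y ∈ S.piece h', x < y}.Subsingleton := by
    intro h hh h' hh'
    by_contra hne
    obtain ⟨x, hx⟩ := (S.piece_nontrivial h).nonempty
    obtain ⟨y, hy⟩ := (S.piece_nontrivial h').nonempty
    exact lt_asymm (hh h' (Ne.symm hne) x hx y hy) (hh' h hne y hy x hx)
  have h2 : {h | ∀ h', h' ≠ h → ∀ x ∈ S.piece h, ∀ y ∈ S.piece h', y < x}.Subsingleton := by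
    intro h hh h' hh'
    by_contra hne
    obtain ⟨x, hx⟩ := (S.piece_nontrivial h).nonempty
    obtain ⟨y, hy⟩ := (S.piece_nontrivial h').nonempty
    exact lt_asymm (hh h' (Ne.symm hne) x hx y hy) (hh' h hne y hy x hx)
  refine (h1.finite.union h2.finite).subset fun h hh => ?_
  exact (S.full h).resolve_left hh

lemma finite_endpoints : S.endpoints.Finite := by
  have key : ∀ (F : Set ℝ → ℝ), (∀ h, F (closure (S.branchDomain h)) = F (S.branchDomain h)) →
      (Set.range fun h => F (S.branchDomain h)).Finite := by
    intro F hF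
    refine ((S.finite_setOf_not_full.image fun h => F (S.branchDomain h)).union
      (finite_singleton (F (Icc a b)))).subset ?_
    rintro _ ⟨h, rfl⟩
    by_cases hh : closure (S.branchDomain h) = Icc a b
    · right
      rw [mem_singleton_iff, ← hh, hF]
    · left
      exact mem_image_of_mem _ hh
  refine (key sInf fun h => ?_).union (key sSup fun h => ?_)
  · have hglb := isGLB_csInf (S.nontrivial_branchDomain h).nonempty (S.bddBelow_branchDomain h)
    rw [IsGLB, ← lowerBounds_closure] at hglb
    exact IsGLB.csInf_eq hglb (S.nontrivial_branchDomain h).nonempty.closure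
  · have hlub := isLUB_csSup (S.nontrivial_branchDomain h).nonempty (S.bddAbove_branchDomain h)
    rw [IsLUB, ← upperBounds_closure] at hlub
    exact IsLUB.csSup_eq hlub (S.nontrivial_branchDomain h).nonempty.closure

/-- A segment that avoids the endpoints of a branch domain lies inside or outside of it. -/
lemma uIcc_subset_branchDomain {h : β} {x y : ℝ} (hxy : Disjoint (uIcc x y) S.endpoints)
    (hx : x ∈ S.branchDomain h) : uIcc x y ⊆ S.branchDomain h := by
  intro t ht
  have hne := (S.nontrivial_branchDomain h).nonempty
  have hsub : uIcc t x ⊆ uIcc x y := uIcc_subset_uIcc ht left_mem_uIcc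
  have h1 : sInf (S.branchDomain h) < t := by
    by_contra! hle
    exact disjoint_left.1 hxy
      (hsub (Icc_subset_uIcc ⟨hle, csInf_le (S.bddBelow_branchDomain h) hx⟩)) (Or.inl ⟨h, rfl⟩)
  have h2 : t < sSup (S.branchDomain h) := by
    by_contra! hle
    exact disjoint_left.1 hxy
      (hsub (Icc_subset_uIcc' ⟨le_csSup (S.bddAbove_branchDomain h) hx, hle⟩)) (Or.inr ⟨h, rfl⟩)
  obtain ⟨u, hu, hut⟩ := exists_lt_of_csInf_lt hne h1
  obtain ⟨w, hw, htw⟩ := exists_lt_of_lt_csSup hne h2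
  exact (S.ordConnected_branchDomain h).out hu hw ⟨hut.le, htw.le⟩

/-- The points at which the series for the transfer operator converges to its class, and whose
preimages under `T` lie in `D`. -/
def goodPoints (f : L1 a b) (D : Set ℝ) : Set ℝ :=
  {x | x ∈ Icc a b ∧ HasSum (S.transferTerm f x) (S.transfer f x) ∧
    ∀ h, x ∈ S.branchDomain h → S.invBranch h x ∈ D}

lemma ae_mem_goodPoints (f : L1 a b) {D : Set ℝ} (hD : ∀ᵐ x ∂intervalMeasure a b, x ∈ D) :
    ∀ᵐ x ∂intervalMeasure a b, x ∈ S.goodPoints f D := by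
  have := S.countable
  have h1 : ∀ h, ∀ᵐ x ∂intervalMeasure a b, x ∈ S.branchDomain h → S.invBranch h x ∈ D := by
    intro h
    refine ae_restrict_of_ae ?_
    have hnull : volume (S.piece h \ D) = 0 := by
      have h2 := ae_restrict_of_ae_restrict_of_subset (S.piece_subset h) hD
      rw [ae_restrict_iff' (S.measurableSet_piece h), ae_iff] at h2
      convert h2 using 2
      ext x
      simp
    have himg := addHaar_image_eq_zero_of_differentiableOn_of_addHaar_eq_zero volume
      ((S.differentiableOn_T h).mono sdiff_subset) hnull
    refine ae_iff.2 (measure_mono_null (fun x hx => ?_) himg)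
    obtain ⟨hx, hxD⟩ := Classical.not_imp.1 hx
    exact ⟨S.invBranch h x, ⟨S.invBranch_mem hx, hxD⟩, S.T_invBranch hx⟩
  filter_upwards [ae_restrict_mem measurableSet_Icc, S.ae_hasSum_transferTerm f,
    ae_all_iff.2 h1] with x hx1 hx2 hx3
  exact ⟨hx1, hx2, hx3⟩

/-- The transfer operator does not increase the broken variation, apart from the effect of the
weight `t ^ 2`: a segment that avoids the break points of `P'` is mapped by each inverse branch to
a segment that avoids those of `P`, and the resulting segments do not overlap. -/
lemma brokenVarLE_transfer {f : L1 a b} {P P' D : Set ℝ} {w : ℝ}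
    (hf : BrokenVarLE P D (fun t => ((t ^ 2 : ℝ) : ℂ) * f t) w)
    (hP : S.T '' P ∪ S.endpoints ⊆ P') :
    BrokenVarLE P' (S.goodPoints f D) (S.transfer f) w := by
  classical
  intro n x y hxy
  let u : Fin n → β → ℂ := fun i h => S.transferTerm f (y i) h - S.transferTerm f (x i) h
  have hu : ∀ i, HasSum (u i) (S.transfer f (y i) - S.transfer f (x i)) := fun i =>
    (hxy.right_mem i).2.1.sub (hxy.left_mem i).2.1
  suffices hA : ∀ A : Finset β, ∑ i, ‖∑ h ∈ A, u i h‖ ≤ w from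
    le_of_tendsto (tendsto_finsetSum _ fun i _ => (hu i).norm) (Eventually.of_forall hA)
  intro A
  have havoid : ∀ i, Disjoint (uIcc (x i) (y i)) S.endpoints := fun i =>
    (hxy.avoid i).mono_right (subset_union_right.trans hP)
  have hmem : ∀ i h, x i ∈ S.branchDomain h → y i ∈ S.branchDomain h := fun i h hx =>
    S.uIcc_subset_branchDomain (havoid i) hx right_mem_uIcc
  let K := {p : Fin n × A // x p.1 ∈ S.branchDomain p.2}
  have hzero : ∀ p : Fin n × A, x p.1 ∉ S.branchDomain p.2 → u p.1 p.2 = 0 := by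
    intro p hx
    have hy : y p.1 ∉ S.branchDomain p.2 := fun hy => hx
      (S.uIcc_subset_branchDomain (uIcc_comm (x p.1) (y p.1) ▸ havoid p.1) hy right_mem_uIcc)
    simp only [u, S.transferTerm_of_notMem _ hx, S.transferTerm_of_notMem _ hy, sub_zero]
  have hmaps : ∀ p : K,
      MapsTo S.T (uIcc (S.invBranch p.1.2 (x p.1.1)) (S.invBranch p.1.2 (y p.1.1)))
        (uIcc (x p.1.1) (y p.1.1)) ∧
      MapsTo S.T (uIoo (S.invBranch p.1.2 (x p.1.1)) (S.invBranch p.1.2 (y p.1.1)))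
        (uIoo (x p.1.1) (y p.1.1)) := by
    rintro ⟨⟨i, h⟩, hx⟩
    have hsub := (S.piece_ordConnected h).uIcc_subset (S.invBranch_mem hx)
      (S.invBranch_mem (hmem i h hx))
    have := mapsTo_uIcc_of_injOn ((S.continuousOn_T h).mono hsub) ((S.injOn_T h).mono hsub)
    rwa [S.T_invBranch hx, S.T_invBranch (hmem i h hx)] at this
  have hpiece : ∀ p : K, uIcc (S.invBranch p.1.2 (x p.1.1)) (S.invBranch p.1.2 (y p.1.1))
      ⊆ S.piece p.1.2 := fun p =>
    (S.piece_ordConnected _).uIcc_subset (S.invBranch_mem p.2) (S.invBranch_mem (hmem _ _ p.2))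
  have hfam : IsSegmentFamily P D (fun p : K => S.invBranch p.1.2 (x p.1.1))
      (fun p : K => S.invBranch p.1.2 (y p.1.1)) := by
    refine ⟨fun p => (hxy.left_mem _).2.2 _ p.2,
      fun p => (hxy.right_mem _).2.2 _ (hmem _ _ p.2), fun p => ?_, fun p q hpq => ?_⟩
    · refine disjoint_left.2 fun t ht htP => ?_
      exact disjoint_left.1 (hxy.avoid p.1.1) ((hmaps p).1 ht)
        (hP (Or.inl (mem_image_of_mem _ htP)))
    · by_cases hh : p.1.2 = q.1.2
      · have hi : p.1.1 ≠ q.1.1 := fun hi => hpq (Subtype.ext (Prod.ext hi hh))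
        exact disjoint_left.2 fun t htp htq =>
          disjoint_left.1 (hxy.disjoint hi) ((hmaps p).2 htp) ((hmaps q).2 htq)
      · exact (S.piece_disjoint fun he => hh (Subtype.ext he)).mono
          (uIoo_subset_uIcc_self.trans (hpiece p)) (uIoo_subset_uIcc_self.trans (hpiece q))
  calc ∑ i, ‖∑ h ∈ A, u i h‖ ≤ ∑ i, ∑ h ∈ A, ‖u i h‖ :=
        Finset.sum_le_sum fun i _ => norm_sum_le _ _
    _ = ∑ p : Fin n × A, ‖u p.1 p.2‖ := by
        rw [Fintype.sum_prod_type]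
        exact Finset.sum_congr rfl fun i _ => (Finset.sum_coe_sort A fun h => ‖u i h‖).symm
    _ = ∑ p : K, ‖u p.1.1 p.1.2‖ := by
        refine (Fintype.sum_of_injective Subtype.val Subtype.val_injective _ _
          (fun p hp => ?_) fun _ => rfl).symm
        rw [hzero p fun hx => hp ⟨⟨p, hx⟩, rfl⟩, norm_zero]
    _ ≤ w := by
        refine le_trans (Finset.sum_le_sum fun p _ => le_of_eq ?_) (hf.sum_le hfam)
        simp only [u, S.transferTerm_of_mem _ p.2, S.transferTerm_of_mem _ (hmem _ _ p.2)]

end IwasawaCF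

/-! ### The Lasota–Yorke inequality -/

/-- Every point of `[a, b]` off a finite set `P` containing `a` and `b` has, on one of its sides, an
interval free of points of `P` whose length depends on `P` only. -/
lemma exists_gap {a b : ℝ} (hab : a < b) (P : Finset ℝ) (ha : a ∈ P) (hb : b ∈ P) :
    ∃ l > 0, ∀ x ∈ Icc a b, x ∉ P →
      (x + l ≤ b ∧ Disjoint (Icc x (x + l)) (P : Set ℝ)) ∨
        (a ≤ x - l ∧ Disjoint (Icc (x - l) x) (P : Set ℝ)) := by
  have hsep : 0 < (P : Set ℝ).infsep :=
    P.finite_toSet.infsep_pos_iff_nontrivial.2 ⟨a, ha, b, hb, hab.ne⟩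
  refine ⟨(P : Set ℝ).infsep / 3, by positivity, fun x hx hxP => ?_⟩
  set l := (P : Set ℝ).infsep / 3 with hl
  by_contra! hcon
  have h1 : ∃ p ∈ P, p ∈ Icc x (x + l) := by
    by_cases hxb : x + l ≤ b
    · obtain ⟨p, hp, hpP⟩ := not_disjoint_iff.1 (hcon.1 hxb)
      exact ⟨p, hpP, hp⟩
    · exact ⟨b, hb, hx.2, (not_le.1 hxb).le⟩
  have h2 : ∃ p ∈ P, p ∈ Icc (x - l) x := by
    by_cases hxa : a ≤ x - l
    · obtain ⟨p, hp, hpP⟩ := not_disjoint_iff.1 (hcon.2 hxa)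
      exact ⟨p, hpP, hp⟩
    · exact ⟨a, ha, (not_le.1 hxa).le, hx.1⟩
  obtain ⟨p, hp, hpx⟩ := h1
  obtain ⟨q, hq, hqx⟩ := h2
  have hpq : p ≠ q := by
    rintro rfl
    exact hxP (le_antisymm hpx.1 hqx.2 ▸ hp)
  have := (P : Set ℝ).infsep_le_dist_of_mem hp hq hpq
  rw [Real.dist_eq, abs_of_nonneg (by linarith [hpx.1, hqx.2])] at this
  linarith [hpx.2, hqx.1]

/-- The supremum off the break points is controlled by the broken variation and the `L¹` norm, since
the intervals between break points are not too short. -/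
lemma BrokenVarLE.norm_le {a b l v : ℝ} {f : L1 a b} {P : Finset ℝ} {D : Set ℝ} (hl : 0 < l)
    (hgap : ∀ x ∈ Icc a b, x ∉ P →
      (x + l ≤ b ∧ Disjoint (Icc x (x + l)) (P : Set ℝ)) ∨
        (a ≤ x - l ∧ Disjoint (Icc (x - l) x) (P : Set ℝ)))
    (hf : BrokenVarLE P D f v) (hD : D ⊆ Icc a b) (hDae : ∀ᵐ x ∂intervalMeasure a b, x ∈ D)
    {x : ℝ} (hx : x ∈ D) (hxP : x ∉ P) : ‖f x‖ ≤ v + ‖f‖ / l := by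
  have key : ∀ s t, s < t → t - s = l → Icc s t ⊆ Icc a b → x ∈ Icc s t →
      Disjoint (Icc s t) (P : Set ℝ) → ‖f x‖ ≤ v + ‖f‖ / l := by
    intro s t hst hl' hsub hxs hdis
    obtain ⟨z, hzD, hz, hle⟩ :=
      exists_norm_mul_le_setIntegral hst (Ioo_subset_Icc_self.trans hsub) f hDae
    have h1 := hf.norm_sub_le hzD hx (hdis.mono_left
      (ordConnected_Icc.uIcc_subset (Ioo_subset_Icc_self hz) hxs))
    have h2 : ‖f z‖ ≤ ‖f‖ / l := by
      rw [le_div_iff₀ hl, ← hl', norm_eq_setIntegral]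
      exact hle.trans (setIntegral_mono_set (integrableOn_coeFn f).norm
        (Eventually.of_forall fun _ => norm_nonneg _)
        (Ioo_subset_Icc_self.trans hsub).eventuallyLE)
    have h3 := norm_sub_norm_le (f x) (f z)
    linarith
  rcases hgap x (hD hx) hxP with ⟨h1, h2⟩ | ⟨h1, h2⟩
  · exact key x (x + l) (by linarith) (by ring) (Icc_subset_Icc (hD hx).1 h1)
      ⟨le_rfl, by linarith⟩ h2
  · exact key (x - l) x (by linarith) (by ring) (Icc_subset_Icc h1 (hD hx).2)
      ⟨by linarith, le_rfl⟩ h2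

/-- The variation is controlled by the broken variation, because each of the finitely many jumps
that the latter ignores is at most twice the supremum. -/
lemma exists_essVar_le_of_brokenVarLE {a b : ℝ} (hab : a < b) (P : Finset ℝ) (ha : a ∈ P)
    (hb : b ∈ P) : ∃ C ≥ 0, ∀ (f : L1 a b) (D : Set ℝ) (v : ℝ), D ⊆ Icc a b →
      (∀ᵐ x ∂intervalMeasure a b, x ∈ D) → BrokenVarLE P D f v →
      essVar f ≤ ENNReal.ofReal ((1 + 2 * P.card) * v + C * ‖f‖) := by
  classical
  obtain ⟨l, hl, hgap⟩ := exists_gap hab P ha hb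
  refine ⟨2 * P.card / l, by positivity, fun f D v hD hDae hf => ?_⟩
  have hv := hf.nonneg
  have hD' : ∀ᵐ x ∂intervalMeasure a b, x ∈ D \ (P : Set ℝ) := by
    have : ∀ᵐ x ∂intervalMeasure a b, x ∉ (P : Set ℝ) :=
      ae_restrict_of_ae (measure_eq_zero_iff_ae_notMem.1 (P.finite_toSet.measure_zero _))
    filter_upwards [hDae, this] with x h1 h2 using ⟨h1, h2⟩
  refine (essVar_le_eVariationOn_of_ae_mem hab hD').trans (iSup_le ?_)
  rintro ⟨n, u, hu, huD⟩
  dsimp only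
  simp_rw [edist_dist]
  rw [← ENNReal.ofReal_sum_of_nonneg fun _ _ => dist_nonneg]
  refine ENNReal.ofReal_le_ofReal ?_
  have hdis : ∀ i j : ℕ, i ≠ j → Disjoint (uIoo (u i) (u (i + 1))) (uIoo (u j) (u (j + 1))) := by
    intro i j hij
    rw [uIoo_of_le (hu i.le_succ), uIoo_of_le (hu j.le_succ)]
    refine disjoint_left.2 fun t ht ht' => ?_
    rcases lt_or_gt_of_ne hij with h | h
    · have := hu (Nat.succ_le_of_lt h)
      exact lt_asymm (ht.2.trans_le this) ht'.1
    · have := hu (Nat.succ_le_of_lt h)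
      exact lt_asymm (ht'.2.trans_le this) ht.1
  let A := (Finset.range n).filter fun i => Disjoint (uIcc (u i) (u (i + 1))) (P : Set ℝ)
  let A' := (Finset.range n).filter fun i => ¬Disjoint (uIcc (u i) (u (i + 1))) (P : Set ℝ)
  have h1 : ∑ i ∈ A, dist (f (u (i + 1))) (f (u i)) ≤ v := by
    have hfam : IsSegmentFamily (P : Set ℝ) D (fun i : A => u i) (fun i : A => u (i + 1)) :=
      ⟨fun i => (huD _).1, fun i => (huD _).1, fun i => (Finset.mem_filter.1 i.2).2,
        fun i j hij => hdis _ _ fun h => hij (Subtype.ext h)⟩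
    have := hf.sum_le hfam
    rw [← Finset.sum_coe_sort]
    simpa only [dist_eq_norm] using this
  have hcard : A'.card ≤ P.card := by
    have hp : ∀ i ∈ A', ∃ p ∈ P, p ∈ uIoo (u i) (u (i + 1)) := by
      intro i hi
      obtain ⟨p, hp, hpP⟩ := not_disjoint_iff.1 (Finset.mem_filter.1 hi).2
      refine ⟨p, hpP, lt_of_le_of_ne hp.1 ?_, lt_of_le_of_ne hp.2 ?_⟩
      · rw [inf_eq_left.2 (hu i.le_succ)]
        exact fun h => (huD i).2 (h ▸ hpP)
      · rw [sup_eq_right.2 (hu i.le_succ)]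
        exact fun h => (huD (i + 1)).2 (h ▸ hpP)
    choose! p hpP hp using hp
    refine Finset.card_le_card_of_injOn p hpP fun i hi j hj hij => ?_
    by_contra hne
    exact disjoint_left.1 (hdis i j hne) (hp i hi) (hij ▸ hp j hj)
  have h2 : ∑ i ∈ A', dist (f (u (i + 1))) (f (u i)) ≤ P.card * (2 * (v + ‖f‖ / l)) := by
    have hB : ∀ i, ‖f (u i)‖ ≤ v + ‖f‖ / l := fun i =>
      hf.norm_le hl hgap hD hDae (huD i).1 (huD i).2
    calc ∑ i ∈ A', dist (f (u (i + 1))) (f (u i)) ≤ ∑ i ∈ A', 2 * (v + ‖f‖ / l) := by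
          refine Finset.sum_le_sum fun i _ => (dist_le_norm_add_norm _ _).trans ?_
          linarith [hB i, hB (i + 1)]
      _ = A'.card * (2 * (v + ‖f‖ / l)) := by rw [Finset.sum_const, nsmul_eq_mul]
      _ ≤ _ := by gcongr
  rw [← Finset.sum_filter_add_sum_filter_not (Finset.range n)
    fun i => Disjoint (uIcc (u i) (u (i + 1))) (P : Set ℝ)]
  refine (add_le_add h1 h2).trans (le_of_eq ?_)
  ring

namespace IwasawaCF

variable {a b : ℝ} {β : Type*} (S : IwasawaCF a b β)

open Classical in
/-- Break points for the iterates of the transfer operator, starting from a set `P`. -/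
noncomputable def breaks (P : Finset ℝ) : ℕ → Finset ℝ
  | 0 => P
  | k + 1 => P ∪ (breaks P k).image S.T

lemma subset_breaks (P : Finset ℝ) (k : ℕ) : P ⊆ S.breaks P k := by
  classical
  cases k with
  | zero => exact Finset.Subset.refl _
  | succ k => exact Finset.subset_union_left

lemma card_breaks_le (P : Finset ℝ) (k : ℕ) : (S.breaks P k).card ≤ (k + 1) * P.card := by
  classical
  induction k with
  | zero => simp [breaks]
  | succ k ih =>
    have h1 := Finset.card_union_le P ((S.breaks P k).image S.T)
    have h2 : ((S.breaks P k).image S.T).card ≤ _ := Finset.card_image_le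
    have h3 : (S.breaks P (k + 1)).card ≤ P.card + ((S.breaks P k).image S.T).card := h1
    linarith

/-- The variation of the iterates of the transfer operator, up to jumps at the break points, decays
exponentially, up to a multiple of the `L¹` norm. -/
lemma exists_brokenVarLE_transfer_pow (hS : S.IsProper) {δ : ℝ} (hδ : 0 ≤ δ)
    (hθ : max |a| |b| ^ 2 + 2 * max |a| |b| * δ ≤ 1) {P : Finset ℝ} (hP : HasMesh P a b δ)
    (hend : S.endpoints ⊆ P) {f : L1 a b} {D : Set ℝ} {v : ℝ} (hD : D ⊆ Icc a b)
    (hDae : ∀ᵐ x ∂intervalMeasure a b, x ∈ D) (hf : BrokenVarLE P D f v) (k : ℕ) :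
    ∃ D' ⊆ Icc a b, (∀ᵐ x ∂intervalMeasure a b, x ∈ D') ∧
      BrokenVarLE (S.breaks P k) D' ((S.transfer ^ k) f)
        ((max |a| |b| ^ 2 + 2 * max |a| |b| * δ) ^ k * v + 2 * k * ‖f‖) := by
  have hγ1 : max |a| |b| < 1 := hS
  set γ := max |a| |b| with hγ
  have hγ0 : 0 ≤ γ := (abs_nonneg a).trans (le_max_left _ _)
  set θ := γ ^ 2 + 2 * γ * δ with hθdef
  have hθ0 : 0 ≤ θ := by positivity
  induction k with
  | zero => exact ⟨D, hD, hDae, by simpa [breaks] using hf⟩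
  | succ k ih =>
    obtain ⟨D', hD', hDae', hk⟩ := ih
    refine ⟨S.goodPoints ((S.transfer ^ k) f) D', fun x hx => hx.1,
      S.ae_mem_goodPoints _ hDae', ?_⟩
    have h1 := hk.sq_mul hD' hDae' hδ (hP.mono (S.subset_breaks P k))
    have h2 := S.brokenVarLE_transfer (P' := S.breaks P (k + 1)) h1 (by
      refine union_subset ?_ (hend.trans (S.subset_breaks P (k + 1)))
      rintro _ ⟨p, hp, rfl⟩
      classical
      exact Finset.mem_union_right _ (Finset.mem_image_of_mem _ hp))
    rw [pow_succ' S.transfer, mul_apply_eq_comp]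
    intro n x y hxy
    refine (h2 n x y hxy).trans ?_
    have h3 := S.norm_transfer_pow_le k f
    have h4 := norm_nonneg f
    have h5 : 2 * γ * ‖(S.transfer ^ k) f‖ ≤ 2 * ‖f‖ := by
      have := norm_nonneg ((S.transfer ^ k) f)
      nlinarith
    have h6 : θ * (2 * k * ‖f‖) ≤ 2 * k * ‖f‖ := mul_le_of_le_one_left (by positivity) hθ
    rw [← hγ, ← hθdef, mul_add, pow_succ', Nat.cast_add_one]
    linarith

/-- A Lasota–Yorke inequality for each iterate of the transfer operator. -/
theorem exists_essVar_transfer_pow_le (hS : S.IsProper) :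
    ∃ c : ℕ → ℝ, Tendsto c atTop (𝓝 0) ∧ (∀ k, 0 ≤ c k) ∧ ∀ k, ∃ C ≥ 0, ∀ f : BV a b,
      essVar ((S.transfer ^ k) (BV.incl a b f))
        ≤ ENNReal.ofReal (c k * ‖f‖ + C * ‖BV.incl a b f‖) := by
  classical
  have hγ1 : max |a| |b| < 1 := hS
  set γ := max |a| |b| with hγ
  have hγ0 : 0 ≤ γ := (abs_nonneg a).trans (le_max_left _ _)
  -- A mesh fine enough for `γ ^ 2 + 2 * γ * δ` to be less than `1`.
  let δ := (1 - γ) / 4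
  have hδ : 0 < δ := by simp only [δ]; linarith
  let θ := γ ^ 2 + 2 * γ * δ
  have hθ0 : 0 ≤ θ := by positivity
  have hθ1 : θ < 1 := by simp only [θ, δ]; nlinarith
  obtain ⟨Q, hQ⟩ := exists_finset_hasMesh a b hδ
  let P : Finset ℝ := insert a (insert b (S.finite_endpoints.toFinset ∪ Q))
  have hQP : Q ⊆ P := fun x hx => by simp [P, hx]
  have hmesh : HasMesh P a b δ := hQ.mono hQP
  have hend : S.endpoints ⊆ P := fun x hx => by simp [P, hx]
  have haP : a ∈ P := by simp [P]
  have hbP : b ∈ P := by simp [P]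
  refine ⟨fun k => (1 + 2 * ((k + 1) * P.card)) * θ ^ k, ?_, fun k => by positivity,
    fun k => ?_⟩
  · have h1 := tendsto_pow_atTop_nhds_zero_of_lt_one hθ0 hθ1
    have h2 := tendsto_self_mul_const_pow_of_lt_one hθ0 hθ1
    have h3 := (h1.const_mul (1 + 2 * (P.card : ℝ))).add (h2.const_mul (2 * (P.card : ℝ)))
    simp only [mul_zero, add_zero] at h3
    exact h3.congr fun k => by ring
  · obtain ⟨C, hC, hvar⟩ := exists_essVar_le_of_brokenVarLE S.lt (S.breaks P k)
      (S.subset_breaks P k haP) (S.subset_breaks P k hbP)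
    refine ⟨(1 + 2 * ((k + 1) * P.card)) * (2 * k) + C, by positivity, fun f => ?_⟩
    rcases eq_or_ne f 0 with rfl | hf0
    · rw [map_zero, map_zero, essVar_zero]
      exact zero_le
    have hpos : 0 < ‖BV.incl a b f‖ := norm_pos_iff.2 fun h =>
      hf0 (BV.incl_injective (by rw [h, map_zero]))
    obtain ⟨g, hg, hgv⟩ := BV.exists_representative f (v := ‖f‖) (by
      rw [BV.norm_def]; linarith)
    obtain ⟨D, hD, hDae, hbr⟩ := S.exists_brokenVarLE_transfer_pow hS hδ.le hθ1.le hmesh hend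
      (fun x hx => hx.1)
      (by filter_upwards [ae_restrict_mem measurableSet_Icc, hg] with x h1 h2 using ⟨h1, h2⟩)
      (brokenVarLE_of_eVariationOn_le P (norm_nonneg f) hgv) k
    refine (hvar _ D _ hD hDae hbr).trans (ENNReal.ofReal_le_ofReal ?_)
    have hcard : ((S.breaks P k).card : ℝ) ≤ (k + 1) * P.card := by
      exact_mod_cast S.card_breaks_le P k
    have hn := S.norm_transfer_pow_le k (BV.incl a b f)
    calc (1 + 2 * ((S.breaks P k).card : ℝ)) * (θ ^ k * ‖f‖ + 2 * k * ‖BV.incl a b f‖)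
          + C * ‖(S.transfer ^ k) (BV.incl a b f)‖
        ≤ (1 + 2 * ((k + 1) * P.card)) * (θ ^ k * ‖f‖ + 2 * k * ‖BV.incl a b f‖)
          + C * ‖BV.incl a b f‖ := by gcongr
      _ = _ := by ring

end IwasawaCF

/-! ### The Ionescu-Tulcea–Marinescu theorem -/

section ITM

variable {B L : Type*} [NormedAddCommGroup B] [NormedSpace ℂ B]
  [NormedAddCommGroup L] [NormedSpace ℂ L]

/-- Bounded sequences of approximate eigenvectors, for an approximate eigenvalue of modulus `1`,
have convergent subsequences. -/
def ApproxEigenvectorCompact (U : L →L[ℂ] L) : Prop :=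
  ∀ (l : ℂ), ‖l‖ = 1 → ∀ (R : ℝ) (f : ℕ → L), (∀ n, ‖f n‖ ≤ R) →
    Tendsto (fun n => l • f n - U (f n)) atTop (𝓝 0) →
      ∃ (φ : ℕ → ℕ) (g : L), StrictMono φ ∧ Tendsto (f ∘ φ) atTop (𝓝 g)

/-- The Lasota–Yorke inequality makes `U` power bounded on `L` as well. -/
lemma ITMHypotheses.exists_norm_pow_le {j : L →ₗ[ℂ] B} {U : L →L[ℂ] L}
    (h : ITMHypotheses j U) (hj : ∀ f, ‖j f‖ ≤ ‖f‖) : ∃ C ≥ 0, ∀ (n : ℕ) (f : L),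
      ‖(U ^ n) f‖ ≤ C * ‖f‖ := by
  obtain ⟨C, hC⟩ := h.power_bounded
  obtain ⟨k, hk, ⟨ρ, M, hρ0, hρ1, hLY⟩, -⟩ := h.lasotaYorke_compact
  have h1ρ : 0 < 1 - ρ := by linarith
  refine ⟨∑ r ∈ Finset.range k, ‖U ^ r‖ + |M| * |C| / (1 - ρ), by positivity, fun n f => ?_⟩
  set K := ∑ r ∈ Finset.range k, ‖U ^ r‖ + |M| * |C| / (1 - ρ) with hK
  have hKM : |M| * |C| ≤ (1 - ρ) * K := by
    rw [hK, mul_add, mul_div_cancel₀ _ h1ρ.ne']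
    have : 0 ≤ (1 - ρ) * ∑ r ∈ Finset.range k, ‖U ^ r‖ := by positivity
    linarith
  induction n using Nat.strong_induction_on with
  | _ n ih =>
    rcases lt_or_ge n k with hn | hn
    · refine ((U ^ n).le_opNorm f).trans ?_
      gcongr
      have := Finset.single_le_sum (f := fun r => ‖U ^ r‖) (fun r _ => norm_nonneg _)
        (Finset.mem_range.2 hn)
      have h2 : 0 ≤ |M| * |C| / (1 - ρ) := by positivity
      linarith
    · obtain ⟨m, rfl⟩ := Nat.exists_eq_add_of_le hn
      rw [pow_add, mul_apply_eq_comp]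
      have h1 := hLY ((U ^ m) f)
      have h2 := ih m (by omega)
      have h3 : ‖j ((U ^ m) f)‖ ≤ |C| * ‖f‖ := (hC m f).trans <|
        mul_le_mul (le_abs_self C) (hj f) (norm_nonneg _) (abs_nonneg _)
      have h4 : M * ‖j ((U ^ m) f)‖ ≤ |M| * (|C| * ‖f‖) :=
        mul_le_mul (le_abs_self M) h3 (norm_nonneg _) (abs_nonneg _)
      have h5 : ρ * ‖(U ^ m) f‖ ≤ ρ * (K * ‖f‖) := by gcongr
      have h6 : |M| * |C| * ‖f‖ ≤ (1 - ρ) * K * ‖f‖ := by gcongr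
      linarith

/-- The image sequence in `B` has a convergent subsequence, and the Lasota–Yorke inequality turns
this into a Cauchy sequence in `L`. -/
lemma ITMHypotheses.approxEigenvectorCompact {j : L →ₗ[ℂ] B} {U : L →L[ℂ] L}
    (h : ITMHypotheses j U) (hj : ∀ f, ‖j f‖ ≤ ‖f‖) : ApproxEigenvectorCompact U := by
  have := h.complete_L
  obtain ⟨k, hk, ⟨ρ, M, hρ0, hρ1, hLY⟩, hcomp⟩ := h.lasotaYorke_compact
  intro l hl R f hf hlim
  have hpow : ∀ m : ℕ, Tendsto (fun n => l ^ m • f n - (U ^ m) (f n)) atTop (𝓝 0) := by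
    intro m
    induction m with
    | zero => simp
    | succ m ih =>
      have h1 := (hlim.const_smul (l ^ m)).add ((U.continuous.tendsto 0).comp ih)
      simp only [smul_zero, map_zero, add_zero] at h1
      refine h1.congr fun n => ?_
      rw [Function.comp_apply, map_sub, map_smul, pow_succ' U, mul_apply_eq_comp, smul_sub,
        smul_smul, ← pow_succ]
      abel
  have he := (hpow k).norm
  rw [norm_zero] at he
  have hbdd : Bornology.IsBounded (Set.range f) := by
    rw [isBounded_iff_forall_norm_le]
    exact ⟨R, by rintro _ ⟨n, rfl⟩; exact hf n⟩
  obtain ⟨y, -, φ, hφ, hy⟩ := (hcomp _ hbdd).tendsto_subseq (x := fun n => j ((U ^ k) (f n)))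
    (fun n => subset_closure ⟨_, ⟨_, mem_range_self n, rfl⟩, rfl⟩)
  have hcau := Metric.cauchySeq_iff.1 hy.cauchySeq
  have heφ := Metric.tendsto_atTop.1 (he.comp hφ.tendsto_atTop)
  suffices hC : CauchySeq (f ∘ φ) by
    obtain ⟨g, hg⟩ := cauchySeq_tendsto_of_complete hC
    exact ⟨φ, g, hφ, hg⟩
  have h1ρ : 0 < 1 - ρ := by linarith
  refine Metric.cauchySeq_iff.2 fun ε hε => ?_
  let η := ε * (1 - ρ) / (2 + 3 * |M| + 1)
  have hη : 0 < η := by positivity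
  obtain ⟨N₁, hN₁⟩ := hcau η hη
  obtain ⟨N₂, hN₂⟩ := heφ η hη
  refine ⟨max N₁ N₂, fun p hp q hq => ?_⟩
  have hdp := hN₂ p (le_of_max_le_right hp)
  have hdq := hN₂ q (le_of_max_le_right hq)
  have hpq := hN₁ p (le_of_max_le_left hp) q (le_of_max_le_left hq)
  simp only [Function.comp_apply, dist_zero_right, norm_norm] at hdp hdq hpq
  rw [dist_eq_norm, ← map_sub, ← map_sub] at hpq
  rw [Function.comp_apply, Function.comp_apply, dist_eq_norm]
  set d := f (φ p) - f (φ q) with hd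
  -- The error made in replacing `l ^ k • d` by `U ^ k d`.
  have herr : ‖l ^ k • d - (U ^ k) d‖ ≤ 2 * η := by
    have : l ^ k • d - (U ^ k) d = (l ^ k • f (φ p) - (U ^ k) (f (φ p)))
        - (l ^ k • f (φ q) - (U ^ k) (f (φ q))) := by
      rw [hd, map_sub, smul_sub]; abel
    rw [this]
    exact (norm_sub_le _ _).trans (by linarith)
  have h1 : ‖d‖ ≤ 2 * η + ‖(U ^ k) d‖ := by
    have := norm_sub_norm_le (l ^ k • d) ((U ^ k) d)
    rw [norm_smul, norm_pow, hl, one_pow, one_mul] at this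
    linarith
  have h2 : ‖j d‖ ≤ 3 * η := by
    have h3 := norm_sub_norm_le (l ^ k • j d) (j ((U ^ k) d))
    rw [norm_smul, norm_pow, hl, one_pow, one_mul, ← map_smul, ← map_sub] at h3
    have := hj (l ^ k • d - (U ^ k) d)
    linarith
  have h3 : M * ‖j d‖ ≤ |M| * (3 * η) :=
    mul_le_mul (le_abs_self M) h2 (norm_nonneg _) (abs_nonneg _)
  have h4 := hLY d
  have h5 : (2 + 3 * |M| + 1) * η = ε * (1 - ρ) := mul_div_cancel₀ _ (by positivity)
  have h6 : ‖d‖ * (1 - ρ) < ε * (1 - ρ) := by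
    rw [← h5]
    linarith
  exact lt_of_mul_lt_mul_right h6 h1ρ.le

variable {U : L →L[ℂ] L}

lemma ApproxEigenvectorCompact.finiteDimensional_eigenspace (hc : ApproxEigenvectorCompact U)
    {l : ℂ} (hl : ‖l‖ = 1) :
    FiniteDimensional ℂ (Module.End.eigenspace (U : Module.End ℂ L) l) := by
  refine FiniteDimensional.of_isCompact_closedBall₀ ℂ one_pos
    (IsSeqCompact.isCompact fun x hx => ?_)
  have hU : ∀ n, U (x n : L) = l • (x n : L) := fun n =>
    Module.End.mem_eigenspace_iff.1 (x n).2
  obtain ⟨φ, g, hφ, hg⟩ := hc l hl 1 (fun n => (x n : L))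
    (fun n => by simpa using hx n) (by simp [hU])
  have hUg : U g = l • g := by
    refine tendsto_nhds_unique ((U.continuous.tendsto g).comp hg) ?_
    simpa only [Function.comp_def, hU] using hg.const_smul l
  let g' : Module.End.eigenspace (U : Module.End ℂ L) l :=
    ⟨g, Module.End.mem_eigenspace_iff.2 hUg⟩
  have hg' : Tendsto (x ∘ φ) atTop (𝓝 g') := tendsto_subtype_rng.2 hg
  exact ⟨g', Metric.isClosed_closedBall.mem_of_tendsto hg'
    (Eventually.of_forall fun n => hx (φ n)), φ, hφ, hg'⟩

/-- The mean ergodic theorem: the averages of `l⁻ⁿ Uⁿ` converge strongly to a projection onto the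
eigenspace of `l`. -/
lemma ApproxEigenvectorCompact.exists_projection [CompleteSpace L]
    (hc : ApproxEigenvectorCompact U) {C : ℝ} (hC : ∀ (n : ℕ) (f : L), ‖(U ^ n) f‖ ≤ C * ‖f‖)
    {l : ℂ} (hl : ‖l‖ = 1) :
    ∃ P : L →L[ℂ] L, (∀ f, U (P f) = l • P f) ∧ (∀ f, U f = l • f → P f = f) ∧
      P * U = U * P := by
  have hl0 : l ≠ 0 := by rintro rfl; simp at hl
  let W : L →L[ℂ] L := l⁻¹ • U
  have hW : ∀ (n : ℕ) (f : L), ‖(W ^ n) f‖ ≤ C * ‖f‖ := by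
    intro n f
    simp only [W, smul_pow]
    rw [smul_apply, norm_smul, norm_pow, norm_inv, hl, inv_one, one_pow,
      one_mul]
    exact hC n f
  let A : ℕ → L →L[ℂ] L := fun N => ((N + 1 : ℕ) : ℂ)⁻¹ • ∑ n ∈ Finset.range (N + 1), W ^ n
  have hAapply : ∀ N f, A N f = ((N + 1 : ℕ) : ℂ)⁻¹ • ∑ n ∈ Finset.range (N + 1), (W ^ n) f := by
    intro N f
    simp [A]
  have hN0 : ∀ N : ℕ, ((N + 1 : ℕ) : ℂ) ≠ 0 := fun N => Nat.cast_ne_zero.2 N.succ_ne_zero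
  have hA : ∀ N f, ‖A N f‖ ≤ C * ‖f‖ := by
    intro N f
    rw [hAapply, norm_smul, norm_inv, Complex.norm_natCast, inv_mul_le_iff₀ (by positivity)]
    refine (norm_sum_le _ _).trans ((Finset.sum_le_sum fun n _ => hW n f).trans (le_of_eq ?_))
    rw [Finset.sum_const, Finset.card_range, nsmul_eq_mul]
  have hcomm : ∀ N, A N * U = U * A N := by
    intro N
    have h1 : Commute U W := (Commute.refl U).smul_right _
    have h2 : Commute U (∑ n ∈ Finset.range (N + 1), W ^ n) :=
      Commute.sum_right _ _ _ fun n _ => h1.pow_right n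
    exact ((h2.smul_right _).eq).symm
  have hcommW : ∀ N f, A N (W f) = W (A N f) := by
    intro N f
    have := congrArg (fun T : L →L[ℂ] L => l⁻¹ • T f) (hcomm N)
    simpa [W, mul_apply_eq_comp] using this
  have htel : ∀ N f, A N f - A N (W f) = ((N + 1 : ℕ) : ℂ)⁻¹ • (f - (W ^ (N + 1)) f) := by
    intro N f
    rw [hAapply, hAapply, ← smul_sub, ← Finset.sum_sub_distrib]
    congr 1
    have : ∀ n ∈ Finset.range (N + 1), (W ^ n) f - (W ^ n) (W f)
        = (W ^ n) f - (W ^ (n + 1)) f := fun n _ => by rw [pow_succ, mul_apply_eq_comp]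
    rw [Finset.sum_congr rfl this, Finset.sum_range_sub']
    simp
  have hcob : ∀ f, Tendsto (fun N => A N f - A N (W f)) atTop (𝓝 0) := by
    intro f
    refine squeeze_zero_norm (a := fun N : ℕ => (‖f‖ + C * ‖f‖) * (1 / ((N : ℝ) + 1)))
      (fun N => ?_) ?_
    · rw [htel, norm_smul, norm_inv, Complex.norm_natCast, mul_comm, one_div,
        Nat.cast_add_one]
      gcongr
      exact (norm_sub_le _ _).trans (add_le_add le_rfl (hW _ f))
    · simpa using tendsto_one_div_add_atTop_nhds_zero_nat.const_mul (‖f‖ + C * ‖f‖)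
  have hfix : ∀ g, W g = g → ∀ N, A N g = g := by
    intro g hg N
    have : ∀ n : ℕ, (W ^ n) g = g := by
      intro n
      induction n with
      | zero => simp
      | succ n ih => rw [pow_succ, mul_apply_eq_comp, hg, ih]
    rw [hAapply]
    simp_rw [this]
    rw [Finset.sum_const, Finset.card_range, ← Nat.cast_smul_eq_nsmul ℂ, smul_smul,
      inv_mul_cancel₀ (hN0 N), one_smul]
  have hUW : ∀ f, U f = l • W f := fun f => by simp [W, smul_smul, mul_inv_cancel₀ hl0]
  have hdiff : ∀ N f, ∃ u, f - A N f = u - W u := by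
    intro N f
    have h1 : ∀ n : ℕ, ∃ u, f - (W ^ n) f = u - W u := by
      intro n
      induction n with
      | zero => exact ⟨0, by simp⟩
      | succ n ih =>
        obtain ⟨u, hu⟩ := ih
        refine ⟨u + (W ^ n) f, ?_⟩
        rw [pow_succ', mul_apply_eq_comp, map_add]
        calc f - W ((W ^ n) f) = (f - (W ^ n) f) + ((W ^ n) f - W ((W ^ n) f)) := by abel
          _ = _ := by rw [hu]; abel
    choose u hu using h1
    refine ⟨((N + 1 : ℕ) : ℂ)⁻¹ • ∑ n ∈ Finset.range (N + 1), u n, ?_⟩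
    rw [map_smul, map_sum, ← smul_sub, ← Finset.sum_sub_distrib,
      ← Finset.sum_congr rfl fun n _ => hu n, Finset.sum_sub_distrib, smul_sub, ← hAapply,
      Finset.sum_const, Finset.card_range, ← Nat.cast_smul_eq_nsmul ℂ, smul_smul,
      inv_mul_cancel₀ (hN0 N), one_smul]
  have hconv : ∀ f, ∃ g, W g = g ∧ Tendsto (fun N => A N f) atTop (𝓝 g) := by
    intro f
    obtain ⟨φ, g, hφ, hg⟩ := hc l hl (C * ‖f‖) (fun N => A N f) (fun N => hA N f) (by
      have := (hcob f).const_smul l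
      rw [smul_zero] at this
      refine this.congr fun N => ?_
      rw [hUW, hcommW, smul_sub])
    have hWg : W g = g := by
      have h1 := (hcob f).comp hφ.tendsto_atTop
      have h2 := hg.sub ((W.continuous.tendsto g).comp hg)
      have h3 : g - W g = 0 := tendsto_nhds_unique h2
        (h1.congr fun N => by simp [Function.comp_apply, hcommW])
      exact (sub_eq_zero.1 h3).symm
    refine ⟨g, hWg, ?_⟩
    -- `f - g` is a limit of coboundaries, whose averages converge to `0`.
    have hzero : Tendsto (fun N => A N (f - g)) atTop (𝓝 0) := by
      rw [Metric.tendsto_atTop]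
      intro ε hε
      have hC0 : 0 < |C| + 1 := by positivity
      obtain ⟨m, hm⟩ := (Metric.tendsto_atTop.1 hg (ε / 2 / (|C| + 1)) (by positivity))
      have hm := hm m le_rfl
      obtain ⟨u, hu⟩ := hdiff (φ m) f
      obtain ⟨N₀, hN₀⟩ := Metric.tendsto_atTop.1 (hcob u) (ε / 2) (by positivity)
      refine ⟨N₀, fun N hN => ?_⟩
      have h1 := hN₀ N hN
      rw [dist_zero_right] at h1 ⊢
      have h2 : f - g = (u - W u) + (A (φ m) f - g) := by rw [← hu]; abel
      rw [Function.comp_apply, dist_eq_norm] at hm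
      have h3 : ‖A N (A (φ m) f - g)‖ ≤ ε / 2 := by
        refine (hA N _).trans ?_
        calc C * ‖A (φ m) f - g‖ ≤ (|C| + 1) * (ε / 2 / (|C| + 1)) := by
              have := le_abs_self C
              gcongr
              linarith
          _ = ε / 2 := mul_div_cancel₀ _ hC0.ne'
      rw [h2, map_add, map_sub]
      exact (norm_add_le _ _).trans_lt (by linarith)
    have h4 := hzero.add_const g
    rw [zero_add] at h4
    refine h4.congr fun N => ?_
    rw [map_sub, hfix g hWg, sub_add_cancel]
  choose p hpW hp using hconv
  let P : L →L[ℂ] L := continuousLinearMapOfTendsto A (tendsto_pi_nhds.2 hp)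
  have hPp : ∀ f, P f = p f := fun f => rfl
  refine ⟨P, fun f => ?_, fun f hf => ?_, ?_⟩
  · rw [hPp, hUW, hpW]
  · have hWf : W f = f := by simp [W, hf, smul_smul, inv_mul_cancel₀ hl0]
    rw [hPp]
    exact tendsto_nhds_unique (hp f) (by simp [hfix f hWf])
  · ext f
    rw [mul_apply_eq_comp, mul_apply_eq_comp, hPp, hPp]
    refine tendsto_nhds_unique (hp (U f)) (((U.continuous.tendsto _).comp (hp f)).congr fun N => ?_)
    exact (congrArg (fun T : L →L[ℂ] L => T f) (hcomm N)).symm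

lemma mem_unitEigenvalues_iff {l : ℂ} :
    l ∈ unitEigenvalues U ↔ ‖l‖ = 1 ∧ ∃ f : L, f ≠ 0 ∧ U f = l • f := by
  refine and_congr_right fun _ => ⟨fun h => ?_, fun ⟨f, hf, hUf⟩ => ?_⟩
  · obtain ⟨f, hf⟩ := h.exists_hasEigenvector
    exact ⟨f, hf.2, hf.apply_eq_smul⟩
  · exact Module.End.hasEigenvalue_of_hasEigenvector
      ⟨Module.End.mem_eigenspace_iff.2 hUf, hf⟩

lemma projection_apply_eq_zero {P : L →L[ℂ] L} {l l' : ℂ} (hP : ∀ f, U (P f) = l • P f)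
    (hPU : P * U = U * P) (hll' : l' ≠ l) {f : L} (hf : U f = l' • f) : P f = 0 := by
  have h1 : P (U f) = U (P f) := congrArg (fun T : L →L[ℂ] L => T f) hPU
  rw [hf, map_smul, hP, ← sub_eq_zero, ← sub_smul, smul_eq_zero] at h1
  exact h1.resolve_left (sub_ne_zero.2 hll')

/-- Eigenvalues of modulus `1` cannot accumulate at `l`: the limit of normalized eigenvectors would
be an eigenvector for `l` in the kernel of the projection onto the eigenspace of `l`. -/
lemma ApproxEigenvectorCompact.finite_unitEigenvalues [CompleteSpace L]
    (hc : ApproxEigenvectorCompact U) {C : ℝ} (hC : ∀ (n : ℕ) (f : L), ‖(U ^ n) f‖ ≤ C * ‖f‖) :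
    (unitEigenvalues U).Finite := by
  by_contra hinf
  obtain ⟨l, hlS, hacc⟩ := Set.Infinite.exists_accPt_of_subset_isCompact hinf
    (isCompact_sphere (0 : ℂ) 1) fun l hl => mem_sphere_zero_iff_norm.2 hl.1
  have hl := mem_sphere_zero_iff_norm.1 hlS
  rw [accPt_principal_iff_clusterPt, ← mem_closure_iff_clusterPt, mem_closure_iff_seq_limit]
    at hacc
  obtain ⟨z, hz, hzl⟩ := hacc
  obtain ⟨P, hP1, hP2, hP3⟩ := hc.exists_projection hC hl
  have hvec : ∀ n, ∃ f : L, ‖f‖ = 1 ∧ U f = z n • f := by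
    intro n
    obtain ⟨-, f, hf0, hf⟩ := mem_unitEigenvalues_iff.1 (hz n).1
    refine ⟨(‖f‖ : ℂ)⁻¹ • f, norm_smul_inv_norm hf0, ?_⟩
    rw [map_smul, hf, smul_comm]
  choose f hf1 hf using hvec
  have hlim : Tendsto (fun n => l • f n - U (f n)) atTop (𝓝 0) := by
    have h1 := (tendsto_iff_norm_sub_tendsto_zero.1 hzl)
    refine squeeze_zero_norm (fun n => le_of_eq ?_) h1
    rw [hf, ← sub_smul, norm_smul, hf1, mul_one, norm_sub_rev]
  obtain ⟨φ, g, hφ, hg⟩ := hc l hl 1 f (fun n => (hf1 n).le) hlim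
  have hUg : U g = l • g := by
    have h1 := (hg.const_smul l).sub ((U.continuous.tendsto g).comp hg)
    exact (sub_eq_zero.1 (tendsto_nhds_unique h1 (hlim.comp hφ.tendsto_atTop))).symm
  have hPg : P g = 0 := by
    refine tendsto_nhds_unique ((P.continuous.tendsto g).comp hg) ?_
    have : ∀ n, (P ∘ f ∘ φ) n = 0 := fun n => projection_apply_eq_zero hP1 hP3 (hz _).2 (hf _)
    exact tendsto_const_nhds.congr fun n => (this n).symm
  have hg1 : ‖g‖ = 1 := tendsto_nhds_unique hg.norm (by simp [hf1])
  rw [hP2 g hUg] at hPg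
  simp [hPg] at hg1

/-- If `V` is power bounded, its spectral radius is at most `1`. -/
lemma spectralRadius_le_one_of_norm_pow_le [CompleteSpace L] (V : L →L[ℂ] L) {C : ℝ}
    (hC : ∀ n : ℕ, ‖V ^ n‖ ≤ C) : spectralRadius ℂ V ≤ 1 := by
  have hlim := spectrum.pow_norm_pow_one_div_tendsto_nhds_spectralRadius V
  have hC' : 0 < max C 1 := lt_max_of_lt_right one_pos
  have h1 : Tendsto (fun n : ℕ => ENNReal.ofReal (max C 1 ^ (1 / n : ℝ))) atTop (𝓝 1) := by
    have h2 : Tendsto (fun n : ℕ => max C 1 ^ (1 / n : ℝ)) atTop (𝓝 (max C 1 ^ (0 : ℝ))) :=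
      (Real.continuousAt_const_rpow hC'.ne').tendsto.comp tendsto_one_div_atTop_nhds_zero_nat
    rw [Real.rpow_zero] at h2
    simpa using ENNReal.tendsto_ofReal h2
  refine le_of_tendsto_of_tendsto' hlim h1 fun n => ENNReal.ofReal_le_ofReal ?_
  exact Real.rpow_le_rpow (norm_nonneg _) ((hC n).trans (le_max_left _ _)) (by positivity)

/-- A boundary point of the spectrum is an approximate eigenvalue. -/
lemma exists_approx_eigenvector [CompleteSpace L] {V : L →L[ℂ] L} {z : ℂ}
    (hz : z ∈ spectrum ℂ V) (hbd : z ∈ closure (spectrum ℂ V)ᶜ) {ε : ℝ} (hε : 0 < ε) :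
    ∃ f : L, ‖f‖ = 1 ∧ ‖z • f - V f‖ ≤ ε := by
  have hnt : Nontrivial L := by
    by_contra hnt
    rw [not_nontrivial_iff_subsingleton] at hnt
    exact hz (isUnit_of_subsingleton _)
  by_contra! hcon
  obtain ⟨w, hw, hwz⟩ := Metric.mem_closure_iff.1 hbd (ε / 4) (by positivity)
  rw [dist_eq_norm] at hwz
  obtain ⟨u, hu⟩ : IsUnit (algebraMap ℂ (L →L[ℂ] L) w - V) := by
    simpa [spectrum.mem_iff] using hw
  have hlow : ∀ f : L, ε * ‖f‖ ≤ ‖z • f - V f‖ := by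
    intro f
    rcases eq_or_ne f 0 with rfl | hf
    · simp
    have h1 := (hcon ((‖f‖ : ℂ)⁻¹ • f) (norm_smul_inv_norm hf)).le
    rw [map_smul, smul_comm, ← smul_sub, norm_smul, norm_inv, Complex.norm_real, norm_norm,
      inv_mul_eq_div, le_div_iff₀ (norm_pos_iff.2 hf)] at h1
    exact h1
  have huapp : ∀ f : L, (u : L →L[ℂ] L) f = w • f - V f := fun f => by
    rw [hu, sub_apply, Algebra.algebraMap_eq_smul_one, smul_apply, one_apply_eq_self]
  have hinv : ‖((u⁻¹ : (L →L[ℂ] L)ˣ) : L →L[ℂ] L)‖ ≤ (ε / 2)⁻¹ := by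
    refine ContinuousLinearMap.opNorm_le_bound _ (by positivity) fun g => ?_
    set f := ((u⁻¹ : (L →L[ℂ] L)ˣ) : L →L[ℂ] L) g with hf
    have hg : (u : L →L[ℂ] L) f = g := by
      rw [hf, ← mul_apply_eq_comp, Units.mul_inv, one_apply_eq_self]
    rw [← div_eq_inv_mul, le_div_iff₀ (by positivity), ← hg, huapp]
    have h1 := hlow f
    have h2 : ‖(z - w) • f‖ ≤ ε / 4 * ‖f‖ := by rw [norm_smul]; gcongr
    have h3 : z • f - V f = (z - w) • f + (w • f - V f) := by rw [sub_smul]; abel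
    rw [h3] at h1
    have h4 := norm_add_le ((z - w) • f) (w • f - V f)
    have h5 : 0 ≤ ε * ‖f‖ := by positivity
    linarith
  have hinv0 : 0 < ‖((u⁻¹ : (L →L[ℂ] L)ˣ) : L →L[ℂ] L)‖ := Units.norm_pos _
  refine hz (Units.ofNearby u (algebraMap ℂ (L →L[ℂ] L) z - V) ?_).isUnit
  rw [hu, sub_sub_sub_cancel_right, ← map_sub, norm_algebraMap']
  refine hwz.trans_le ?_
  have := inv_anti₀ hinv0 hinv
  rw [inv_inv] at this
  linarith

/-- The peripheral spectrum is split off by the sum `Q` of the projections onto the eigenspaces, and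
the remainder `V = U (1 - Q)` has no spectrum on the unit circle: an approximate eigenvector of `V`
would yield an eigenvector of `U` in the kernel of `Q`. -/
theorem ApproxEigenvectorCompact.hasITMDecomposition [CompleteSpace L]
    (hc : ApproxEigenvectorCompact U) {C : ℝ} (hC : ∀ (n : ℕ) (f : L), ‖(U ^ n) f‖ ≤ C * ‖f‖) :
    HasITMDecomposition U := by
  have hG := hc.finite_unitEigenvalues hC
  have hex : ∀ l : ℂ, ∃ P : L →L[ℂ] L, l ∈ unitEigenvalues U →
      (∀ f, U (P f) = l • P f) ∧ (∀ f, U f = l • f → P f = f) ∧ P * U = U * P := by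
    intro l
    by_cases hl : l ∈ unitEigenvalues U
    · obtain ⟨P, hP⟩ := hc.exists_projection hC hl.1
      exact ⟨P, fun _ => hP⟩
    · exact ⟨0, fun h => absurd h hl⟩
  choose P hP using hex
  set G := hG.toFinset with hGdef
  have hmem : ∀ {l}, l ∈ G ↔ l ∈ unitEigenvalues U := fun {l} => hG.mem_toFinset
  have hUP : ∀ l ∈ unitEigenvalues U, U * P l = l • P l := fun l hl => by
    ext f; exact (hP l hl).1 f
  have hPP : ∀ l ∈ unitEigenvalues U, P l * P l = P l := fun l hl => by
    ext f; exact (hP l hl).2.1 _ ((hP l hl).1 f)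
  have hPP' : ∀ l ∈ unitEigenvalues U, ∀ l' ∈ unitEigenvalues U, l' ≠ l → P l * P l' = 0 := by
    intro l hl l' hl' hne
    ext f
    exact projection_apply_eq_zero (hP l hl).1 (hP l hl).2.2 hne ((hP l' hl').1 f)
  let Q : L →L[ℂ] L := ∑ l ∈ G, P l
  have hPQ : ∀ l ∈ unitEigenvalues U, P l * Q = P l := by
    intro l hl
    simp only [Q, Finset.mul_sum]
    rw [Finset.sum_eq_single l, hPP l hl]
    · exact fun l' hl' hne => hPP' l hl l' (hmem.1 hl') hne
    · exact fun h => absurd (hmem.2 hl) h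
  have hQP : ∀ l ∈ unitEigenvalues U, Q * P l = P l := by
    intro l hl
    simp only [Q, Finset.sum_mul]
    rw [Finset.sum_eq_single l, hPP l hl]
    · exact fun l' hl' hne => hPP' l' (hmem.1 hl') l hl hne.symm
    · exact fun h => absurd (hmem.2 hl) h
  have hQQ : Q * Q = Q := by
    change (∑ l ∈ G, P l) * Q = ∑ l ∈ G, P l
    rw [Finset.sum_mul]
    exact Finset.sum_congr rfl fun l hl => hPQ l (hmem.1 hl)
  have hQU : Commute Q U := Commute.sum_left _ _ _ fun l hl => (hP l (hmem.1 hl)).2.2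
  let V : L →L[ℂ] L := U * (1 - Q)
  have hQid : IsIdempotentElem (1 - Q) := IsIdempotentElem.one_sub hQQ
  have hVpow : ∀ n : ℕ, 1 ≤ n → V ^ n = U ^ n * (1 - Q) := by
    intro n hn
    obtain ⟨m, rfl⟩ := Nat.exists_eq_add_of_le' hn
    have : Commute U (1 - Q) := (Commute.one_right U).sub_right hQU.symm
    rw [this.mul_pow, hQid.pow_succ_eq]
  have hUpowP : ∀ (n : ℕ), ∀ l ∈ unitEigenvalues U, U ^ n * P l = l ^ n • P l := by
    intro n l hl
    induction n with
    | zero => simp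
    | succ n ih => rw [pow_succ, mul_assoc, hUP l hl, mul_smul_comm, ih, smul_smul, pow_succ']
  have hQV : Q * V = 0 := by
    change Q * (U * (1 - Q)) = 0
    rw [← mul_assoc, hQU.eq, mul_assoc, mul_sub, mul_one, hQQ, sub_self, mul_zero]
  have hPV : ∀ l ∈ unitEigenvalues U, P l * V = 0 := fun l hl => by
    rw [← hPQ l hl, mul_assoc, hQV, mul_zero]
  have hVP : ∀ l ∈ unitEigenvalues U, V * P l = 0 := fun l hl => by
    change U * (1 - Q) * P l = 0
    rw [mul_assoc, sub_mul, one_mul, hQP l hl, sub_self, mul_zero]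
  refine ⟨hG, fun l hl => hc.finiteDimensional_eigenspace hl.1, P, V, fun n hn => ?_, hPP, hPP',
    fun l hl => ⟨hPV l hl, hVP l hl⟩, fun l hl => ?_, ?_⟩
  · rw [hVpow n hn, mul_sub, mul_one]
    have : U ^ n * Q = ∑ l ∈ G, l ^ n • P l := by
      simp only [Q, Finset.mul_sum]
      exact Finset.sum_congr rfl fun l hl => hUpowP n l (hmem.1 hl)
    rw [this, add_sub_cancel]
  · ext f
    rw [LinearMap.mem_range, Module.End.mem_eigenspace_iff]
    constructor
    · rintro ⟨g, rfl⟩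
      exact (hP l hl).1 g
    · exact fun hf => ⟨f, (hP l hl).2.1 f hf⟩
  · have hr1 : spectralRadius ℂ V ≤ 1 := by
      refine spectralRadius_le_one_of_norm_pow_le V (C := max 1 (|C| * ‖1 - Q‖)) fun n => ?_
      rcases Nat.eq_zero_or_pos n with rfl | hn
      · rw [pow_zero]
        exact ContinuousLinearMap.norm_id_le.trans (le_max_left _ _)
      · rw [hVpow n hn]
        refine (norm_mul_le _ _).trans (le_trans ?_ (le_max_right _ _))
        gcongr
        exact ContinuousLinearMap.opNorm_le_bound _ (abs_nonneg _) fun f =>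
          (hC n f).trans (mul_le_mul_of_nonneg_right (le_abs_self _) (norm_nonneg _))
    refine lt_of_le_of_ne hr1 fun hr => ?_
    have hne : (spectrum ℂ V).Nonempty := by
      by_contra hemp
      rw [not_nonempty_iff_eq_empty] at hemp
      simp [spectralRadius, hemp] at hr
    obtain ⟨z, hz, hzr⟩ := spectrum.exists_nnnorm_eq_spectralRadius_of_nonempty hne
    rw [hr] at hzr
    have hz1 : ‖z‖ = 1 := by
      have : ‖z‖₊ = 1 := by exact_mod_cast hzr
      simpa using congrArg NNReal.toReal this
    -- `z` is a limit of the points `(1 + 1 / (n + 1)) z`, which lie outside of the unit disc.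
    have hbd : z ∈ closure (spectrum ℂ V)ᶜ := by
      refine mem_closure_of_tendsto (f := fun n : ℕ => ((1 + 1 / ((n : ℝ) + 1) : ℝ) : ℂ) * z)
        (b := atTop) ?_ (Eventually.of_forall fun n hn => ?_)
      · have h1 := (tendsto_one_div_add_atTop_nhds_zero_nat (𝕜 := ℝ)).const_add 1
        rw [add_zero] at h1
        simpa using ((Complex.continuous_ofReal.tendsto 1).comp h1).mul_const z
      · have h2 : (‖((1 + 1 / ((n : ℝ) + 1) : ℝ) : ℂ) * z‖₊ : ℝ≥0∞) ≤ 1 :=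
          (le_iSup₂ (f := fun k (_ : k ∈ spectrum ℂ V) => (‖k‖₊ : ℝ≥0∞)) _ hn).trans hr1
        have h3 : ‖((1 + 1 / ((n : ℝ) + 1) : ℝ) : ℂ) * z‖ ≤ 1 := by
          have : ‖((1 + 1 / ((n : ℝ) + 1) : ℝ) : ℂ) * z‖₊ ≤ 1 := by exact_mod_cast h2
          exact_mod_cast this
        have h4 : (0 : ℝ) < 1 / ((n : ℝ) + 1) := by positivity
        rw [norm_mul, hz1, mul_one, Complex.norm_real, Real.norm_of_nonneg (by positivity)] at h3
        linarith
    have happ : ∀ n : ℕ, ∃ f : L, ‖f‖ = 1 ∧ ‖z • f - V f‖ ≤ 1 / ((n : ℝ) + 1) := fun n =>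
      exists_approx_eigenvector hz hbd (by positivity)
    choose f hf1 hf using happ
    have hlim : Tendsto (fun n => z • f n - V (f n)) atTop (𝓝 0) :=
      squeeze_zero_norm hf tendsto_one_div_add_atTop_nhds_zero_nat
    have hz0 : z ≠ 0 := by rintro rfl; simp at hz1
    have hQVf : ∀ g, Q (V g) = 0 := fun g => congrArg (fun T : L →L[ℂ] L => T g) hQV
    have hQf : Tendsto (fun n => z • Q (f n)) atTop (𝓝 0) := by
      have := (Q.continuous.tendsto 0).comp hlim
      rw [map_zero] at this
      exact this.congr fun n => by rw [Function.comp_apply, map_sub, map_smul, hQVf, sub_zero]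
    have hQf' : Tendsto (fun n => Q (f n)) atTop (𝓝 0) := by
      have := hQf.const_smul z⁻¹
      rw [smul_zero] at this
      exact this.congr fun n => by rw [smul_smul, inv_mul_cancel₀ hz0, one_smul]
    have hVf : ∀ n, V (f n) = U (f n - Q (f n)) := fun n => rfl
    obtain ⟨φ, g, hφ, hg⟩ := hc z hz1 (1 + ‖Q‖) (fun n => f n - Q (f n))
      (fun n => (norm_sub_le _ _).trans (by
        have := Q.le_opNorm (f n)
        rw [hf1, mul_one] at this
        rw [hf1]
        linarith)) (by
      have := hlim.sub hQf
      rw [sub_zero] at this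
      exact this.congr fun n => by rw [← hVf, smul_sub]; abel)
    have hUg : U g = z • g := by
      have h1 := (hg.const_smul z).sub ((U.continuous.tendsto g).comp hg)
      have h2 := (hlim.sub hQf).comp hφ.tendsto_atTop
      rw [sub_zero] at h2
      refine (sub_eq_zero.1 (tendsto_nhds_unique h1 (h2.congr fun n => ?_))).symm
      simp only [Function.comp_apply]
      rw [← hVf, smul_sub]; abel
    have hg1 : ‖g‖ = 1 := by
      have h1 : Tendsto (fun n => f (φ n)) atTop (𝓝 g) := by
        have := hg.add (hQf'.comp hφ.tendsto_atTop)
        rw [add_zero] at this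
        exact this.congr fun n => by simp
      exact tendsto_nhds_unique h1.norm (by simp [hf1])
    have hQg : Q g = 0 := by
      refine tendsto_nhds_unique ((Q.continuous.tendsto g).comp hg) ?_
      refine tendsto_const_nhds.congr fun n => ?_
      have : Q (Q (f (φ n))) = Q (f (φ n)) := congrArg (fun T : L →L[ℂ] L => T (f (φ n))) hQQ
      simp [this]
    have hg0 : g ≠ 0 := by rintro rfl; simp at hg1
    have hzG : z ∈ unitEigenvalues U := mem_unitEigenvalues_iff.2 ⟨hz1, g, hg0, hUg⟩
    have h1 : P z (Q g) = P z g := congrArg (fun T : L →L[ℂ] L => T g) (hPQ z hzG)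
    rw [hQg, map_zero, (hP z hzG).2.1 g hUg] at h1
    exact hg0 h1.symm

/-- The Ionescu-Tulcea–Marinescu theorem. -/
theorem ITMHypotheses.hasITMDecomposition {j : L →ₗ[ℂ] B} (h : ITMHypotheses j U)
    (hj : ∀ f, ‖j f‖ ≤ ‖f‖) : HasITMDecomposition U := by
  have := h.complete_L
  obtain ⟨C, -, hC⟩ := h.exists_norm_pow_le hj
  exact (h.approxEigenvectorCompact hj).hasITMDecomposition hC

/-- In the decomposition `Uⁿ = ∑ lⁿ P_l + Vⁿ` the first part has finite rank and the second part
tends to `0` in norm. -/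
theorem HasITMDecomposition.isQuasiCompact [CompleteSpace L] (h : HasITMDecomposition U)
    (hr : spectralRadius ℂ U = 1) : IsQuasiCompact U := by
  obtain ⟨hG, hfin, P, V, hpow, -, -, -, hrange, hV⟩ := h
  obtain ⟨n, hn, hVn⟩ : ∃ n : ℕ, 1 ≤ n ∧ ‖V ^ n‖ₑ < 1 := by
    have hlim := spectrum.pow_nnnorm_pow_one_div_tendsto_nhds_spectralRadius V
    obtain ⟨n, hn1, hn⟩ := ((hlim.eventually_lt_const hV).and (eventually_ge_atTop 1)).exists
    refine ⟨n, hn, ?_⟩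
    by_contra! hge
    exact absurd hn1 (not_lt.2 (ENNReal.one_le_rpow hge (by positivity)))
  refine ⟨n, hn, ∑ l ∈ hG.toFinset, l ^ n • P l, ?_, ?_⟩
  · have hP : ∀ l ∈ unitEigenvalues U, IsCompactOperator (P l) := by
      intro l hl
      have := hfin l hl
      let P' : L →L[ℂ] Module.End.eigenspace (U : Module.End ℂ L) l :=
        (P l).codRestrict _ fun f => hrange l hl ▸ LinearMap.mem_range_self (P l : L →ₗ[ℂ] L) f
      have hid : IsCompactOperator (id : Module.End.eigenspace (U : Module.End ℂ L) l → _) :=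
        (isCompactOperator_id_iff_finiteDimensional (𝕜 := ℂ)).2 this
      exact (hid.comp_clm P').continuous_comp continuous_subtype_val
    exact (compactOperator (RingHom.id ℂ) L L).sum_mem (t := hG.toFinset)
      (f := fun l => l ^ n • P l)
      fun l hl => Submodule.smul_mem _ _ (hP l (hG.mem_toFinset.1 hl))
  · rw [hpow n hn, add_sub_cancel_left, hr, one_pow]
    exact hVn

end ITM

namespace IwasawaCF

variable {a b : ℝ} {β : Type*} (S : IwasawaCF a b β)

/-! ### The transfer operator on `BV(I)` -/

/-- The transfer operator maps `BV(I)` to itself and is bounded there. -/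
theorem exists_bvTransfer (hS : S.IsProper) :
    ∃ H : BV a b →L[ℂ] BV a b, ∀ f, BV.incl a b (H f) = S.transfer (BV.incl a b f) := by
  obtain ⟨c, -, hc0, hc⟩ := S.exists_essVar_transfer_pow_le hS
  obtain ⟨C, hC0, hC⟩ := hc 1
  simp only [pow_one] at hC
  have hex : ∀ f : BV a b, ∃ g : BV a b, BV.incl a b g = S.transfer (BV.incl a b f) := fun f =>
    BV.exists_incl_eq ((hC f).trans_lt ENNReal.ofReal_lt_top)
  choose H hH using hex
  refine ⟨LinearMap.mkContinuous
    { toFun := H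
      map_add' := fun f g => BV.incl_injective (by simp only [hH, map_add])
      map_smul' := fun z f => BV.incl_injective (by
        simp only [hH, map_smul, RingHom.id_apply]) } (1 + c 1 + C) fun f => ?_, hH⟩
  have h1 := S.norm_transfer_le (BV.incl a b f)
  have h2 := BV.norm_incl_le f
  have hc1 := hc0 1
  have h3 := ENNReal.toReal_le_of_le_ofReal (by positivity) (hC f)
  have h4 : C * ‖BV.incl a b f‖ ≤ C * ‖f‖ := by gcongr
  change ‖H f‖ ≤ _
  rw [BV.norm_def, hH]
  linarith

variable {S}

lemma incl_pow {H : BV a b →L[ℂ] BV a b}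
    (hH : ∀ f, BV.incl a b (H f) = S.transfer (BV.incl a b f)) (n : ℕ) (f : BV a b) :
    BV.incl a b ((H ^ n) f) = (S.transfer ^ n) (BV.incl a b f) := by
  induction n with
  | zero => simp
  | succ n ih => rw [pow_succ', mul_apply_eq_comp, hH, ih, pow_succ', mul_apply_eq_comp]

/-- The Lasota–Yorke inequality is used for an iterate with contraction factor at most `1 / 2`. -/
theorem itmHypotheses (hS : S.IsProper) {H : BV a b →L[ℂ] BV a b}
    (hH : ∀ f, BV.incl a b (H f) = S.transfer (BV.incl a b f)) :
    ITMHypotheses (BV.incl a b) H where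
  complete_B := inferInstance
  complete_L := BV.completeSpace S.lt
  inclusion := BV.incl_injective
  bounded := ⟨1, fun f => by rw [one_mul, hH]; exact S.norm_transfer_le _⟩
  closed_ball M f g hf hfg := BV.exists_of_tendsto_incl S.lt M f g hf hfg
  power_bounded := ⟨1, fun n f => by
    rw [one_mul, incl_pow hH]; exact S.norm_transfer_pow_le n _⟩
  lasotaYorke_compact := by
    obtain ⟨c, hc, hc0, hvar⟩ := S.exists_essVar_transfer_pow_le hS
    obtain ⟨k, hck, hk⟩ := ((hc.eventually_le_const (show (0 : ℝ) < 1 / 2 by norm_num)).and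
      (eventually_ge_atTop 1)).exists
    obtain ⟨C, hC0, hC⟩ := hvar k
    refine ⟨k, hk, ⟨1 / 2, 1 + C, by norm_num, by norm_num, fun f => ?_⟩, fun L' hL' => ?_⟩
    · have hck0 := hc0 k
      have h1 := ENNReal.toReal_le_of_le_ofReal (by positivity) (hC f)
      have h2 := S.norm_transfer_pow_le k (BV.incl a b f)
      have h3 : c k * ‖f‖ ≤ 1 / 2 * ‖f‖ := by gcongr
      rw [BV.norm_def ((H ^ k) f), incl_pow hH]
      linarith
    · refine BV.isCompact_closure_image_incl S.lt ?_
      obtain ⟨R, hR⟩ := hL'.exists_norm_le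
      rw [isBounded_iff_forall_norm_le]
      refine ⟨‖H ^ k‖ * R, ?_⟩
      rintro _ ⟨f, hf, rfl⟩
      exact ((H ^ k).le_opNorm f).trans (by gcongr; exact hR f hf)

/-- The value `1` belongs to the spectrum, because the range of `1 - H` consists of functions of
integral `0`. -/
lemma one_mem_spectrum {H : BV a b →L[ℂ] BV a b}
    (hH : ∀ f, BV.incl a b (H f) = S.transfer (BV.incl a b f)) : (1 : ℂ) ∈ spectrum ℂ H := by
  intro hu
  obtain ⟨u, hu⟩ := hu
  have hone : Integrable (fun _ : ℝ => (1 : ℂ)) (intervalMeasure a b) := integrable_const 1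
  have hvar : essVar (hone.toL1 _) < ∞ := by
    refine (essVar_le hone.coeFn_toL1.symm).trans_lt ?_
    rw [eVariationOn.constant_on]
    · exact ENNReal.zero_lt_top
    · exact (subsingleton_singleton (a := (1 : ℂ))).anti (by rintro _ ⟨_, _, rfl⟩; rfl)
  obtain ⟨e, he⟩ := BV.exists_incl_eq hvar
  obtain ⟨f, hf⟩ : ∃ f, f - H f = e := by
    refine ⟨((u⁻¹ : (BV a b →L[ℂ] BV a b)ˣ) : BV a b →L[ℂ] BV a b) e, ?_⟩
    have h1 : (u : BV a b →L[ℂ] BV a b) (((u⁻¹ : (BV a b →L[ℂ] BV a b)ˣ) :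
        BV a b →L[ℂ] BV a b) e) = e := by
      rw [← mul_apply_eq_comp, Units.mul_inv, one_apply_eq_self]
    rw [hu, map_one, sub_apply, one_apply_eq_self] at h1
    exact h1
  have h1 : BV.incl a b f - S.transfer (BV.incl a b f) = hone.toL1 _ := by
    rw [← hH, ← map_sub, hf, he]
  have h2 : ∫ x in Icc a b, (BV.incl a b f - S.transfer (BV.incl a b f) : L1 a b) x = 0 := by
    rw [integral_congr_ae (Lp.coeFn_sub _ _)]
    simp only [Pi.sub_apply]
    rw [integral_sub (L1.integrable_coeFn _) (L1.integrable_coeFn _), S.integral_transfer,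
      sub_self]
  rw [h1, integral_congr_ae hone.coeFn_toL1, setIntegral_const, Real.volume_real_Icc_of_le S.lt.le,
    Complex.real_smul, mul_one] at h2
  exact (sub_pos.2 S.lt).ne' (by exact_mod_cast h2)

end IwasawaCF

theorem mainTheorem5 {a b : ℝ} {β : Type*} (S : IwasawaCF a b β) (hS : S.IsProper) :
    ∃ (H₁ : L1 a b →L[ℂ] L1 a b) (H : BV a b →L[ℂ] BV a b),
      S.IsTransferOperator H₁ ∧
      (∀ f : BV a b, BV.incl a b (H f) = H₁ (BV.incl a b f)) ∧
      ITMHypotheses (BV.incl a b) H ∧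
      HasITMDecomposition H ∧
      spectralRadius ℂ H = 1 ∧
      IsQuasiCompact H := by
  obtain ⟨H, hH⟩ := S.exists_bvTransfer hS
  have hitm := IwasawaCF.itmHypotheses hS hH
  have hdec := hitm.hasITMDecomposition BV.norm_incl_le
  have := BV.completeSpace S.lt
  obtain ⟨C, -, hC⟩ := hitm.exists_norm_pow_le BV.norm_incl_le
  have hr : spectralRadius ℂ H = 1 := by
    refine le_antisymm (spectralRadius_le_one_of_norm_pow_le H (C := |C|) fun n => ?_) ?_
    · exact ContinuousLinearMap.opNorm_le_bound _ (abs_nonneg _) fun f =>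
        (hC n f).trans (mul_le_mul_of_nonneg_right (le_abs_self _) (norm_nonneg _))
    · have := le_iSup₂ (f := fun k (_ : k ∈ spectrum ℂ H) => (‖k‖₊ : ℝ≥0∞)) 1
        (IwasawaCF.one_mem_spectrum hH)
      rwa [nnnorm_one, ENNReal.coe_one] at this
  exact ⟨S.transfer, H, S.isTransferOperator_transfer, hH, hitm, hdec, hr,
    hdec.isQuasiCompact hr⟩
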